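/- Let $C=(c_{ij})_{i,j\in[d]}$ be a network on $d$ vertices, i.e. a symmetric matrix of non-negative weights with zero diagonal (connectivity and a normalization of the total weight are not assumed), with at least one positive weight. For $A\in\mathbb R$ let $\pi_{A,C}$ be the probability measure on $[0,1]^d$ with density proportional to $\exp\{-A^2\sum_{i<j}c_{ij}(p_i-p_j)^2\}$. Let $K_{A,C}$ be the Gibbs sampler for $\pi_{A,C}$: from $\mathbf p\in[0,1]^d$, a coordinate $i\in[d]$ is chosen uniformly at random and $p_i$ is replaced by a sample from its conditional distribution under $\pi_{A,C}$ given the other coordinates. Let $K_{A,C}^{*k}(\mathbf p)$ be the law after $k$ steps started from $\mathbf p$. For Borel probability measures $\mu,\nu$ on $[0,1]^d$ let $$d_\infty(\mu,\nu)=\inf\ \mathbb E\big[\|\mathbf p-\mathbf q\|_\infty\big],$$ the infimum being over all couplings of $\mathbf p\sim\mu$ and $\mathbf q\sim\nu$, where $\|\cdot\|_\infty$ is the sup norm. Then for every $\delta>0$ there are constants $\alpha=\alpha(C,\delta)>0$, $\alpha'=\alpha'(C,\delta)>0$ and $A^*=A^*(C,\delta)$ such that, for all $A\ge A^*$ and all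 integers $k\ge 0$: - if $k\le\alpha A^2$, then $\displaystyle\sup_{\mathbf p\in[0,1]^d}d_\infty\big(K_{A,C}^{*k}(\mathbf p),\pi_{A,C}\big)\ge\tfrac14-\delta$; - if $k\ge\alpha' A^2$, then $\displaystyle\sup_{\mathbf p\in[0,1]^d}d_\infty\big(K_{A,C}^{*k}(\mathbf p),\pi_{A,C}\big)\le\delta$. -/

import Mathlib

open MeasureTheory ProbabilityTheory
open scoped ENNReal

noncomputable section

namespace GibbsSampler

/-- A network on `d` vertices: a symmetric matrix of non-negative weights without loops.
No connectivity and no normalization of the total weight is required. -/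
structure Network (d : ℕ) where
  /-- The weight `c i j` of the pair `{i, j}`; there is an edge between `i` and `j` when it is
  positive. -/
  weight : Fin d → Fin d → ℝ
  symm : ∀ i j, weight i j = weight j i
  nonneg : ∀ i j, 0 ≤ weight i j
  loopless : ∀ i, weight i i = 0

/-- The hypercube `[0,1]^d`. Its distance is the one of the sup norm, its measurable structure is
the Borel one, and `volume` is the Lebesgue measure on it. -/
abbrev Cube (d : ℕ) : Type := Fin d → unitInterval

/-- The quadratic form `∑_{i < j} c_{ij} (p_i - p_j)^2`. -/
def energy {d : ℕ} (C : Network d) (p : Cube d) : ℝ :=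
  ∑ i : Fin d, ∑ j ∈ Finset.Ioi i, C.weight i j * ((p i : ℝ) - (p j : ℝ)) ^ 2

/-- The probability measure on `[0,1]^d` with Lebesgue density
`Z⁻¹ exp (-A² ∑_{i < j} c_{ij} (p_i - p_j)^2)`. (`Measure.tilted μ f` is the normalized measure
`exp f dμ / ∫ exp f dμ`.) -/
def stationary {d : ℕ} (C : Network d) (A : ℝ) : Measure (Cube d) :=
  (volume : Measure (Cube d)).tilted (fun p => -A ^ 2 * energy C p)

/-- The conditional distribution under `stationary C A` of the `i`-th coordinate, given that the
other coordinates are those of `p`: on `[0,1]`, its density at `x` is proportional to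
`exp (-A² energy (p_1, …, p_{i-1}, x, p_{i+1}, …, p_d))`. -/
def coordConditional {d : ℕ} (C : Network d) (A : ℝ) (i : Fin d) (p : Cube d) :
    Measure unitInterval :=
  (volume : Measure unitInterval).tilted (fun x => -A ^ 2 * energy C (Function.update p i x))

/-- The law after one step of the Gibbs sampler from `p`: a coordinate `i` is chosen uniformly at
random and is resampled from its conditional distribution given the other coordinates. -/
def gibbsStep {d : ℕ} (C : Network d) (A : ℝ) (p : Cube d) : Measure (Cube d) :=
  ∑ i : Fin d, (d : ℝ≥0∞)⁻¹ • (coordConditional C A i p).map (Function.update p i)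

theorem measurable_energy {d : ℕ} (C : Network d) : Measurable (energy C) := by
  unfold energy
  fun_prop

theorem measurable_energy_update {d : ℕ} (C : Network d) (i : Fin d) :
    Measurable (fun z : Cube d × unitInterval => energy C (Function.update z.1 i z.2)) :=
  (measurable_energy C).comp measurable_update'

theorem measurable_gibbsStep {d : ℕ} (C : Network d) (A : ℝ) :
    Measurable (gibbsStep C A) := by
  refine Measure.measurable_of_measurable_coe _ fun s hs => ?_
  simp only [gibbsStep, Measure.coe_finsetSum, Finset.sum_apply, Measure.smul_apply, smul_eq_mul]
  refine Finset.measurable_sum _ fun i _ => Measurable.const_mul ?_ _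
  have hf : Measurable (fun z : Cube d × unitInterval =>
      Real.exp (-A ^ 2 * energy C (Function.update z.1 i z.2))) :=
    ((measurable_energy_update C i).const_mul _).exp
  have hZ : Measurable (fun p : Cube d =>
      ∫ x : unitInterval, Real.exp (-A ^ 2 * energy C (Function.update p i x))) :=
    (hf.stronglyMeasurable.integral_prod_right).measurable
  have hS : MeasurableSet {z : Cube d × unitInterval | Function.update z.1 i z.2 ∈ s} :=
    measurable_update' hs
  have key : ∀ p : Cube d, (coordConditional C A i p).map (Function.update p i) s =
      ∫⁻ x : unitInterval, {z : Cube d × unitInterval | Function.update z.1 i z.2 ∈ s}.indicator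
        (fun z => ENNReal.ofReal (Real.exp (-A ^ 2 * energy C (Function.update z.1 i z.2)) /
          ∫ y : unitInterval, Real.exp (-A ^ 2 * energy C (Function.update z.1 i y)))) (p, x) := by
    intro p
    have hm : MeasurableSet (Function.update p i ⁻¹' s) := measurable_update p hs
    rw [Measure.map_apply (measurable_update p) hs, coordConditional, Measure.tilted,
      withDensity_apply _ hm, ← lintegral_indicator hm]
    rfl
  simp only [key]
  exact Measurable.lintegral_prod_right'
    ((hf.div (hZ.comp measurable_fst)).ennreal_ofReal.indicator hS)

/-- The transition kernel of the Gibbs sampler. Powers are taken for the composition of kernels, so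
that `(gibbsKernel C A ^ k) p` is the law after `k` steps started from `p`. -/
def gibbsKernel {d : ℕ} (C : Network d) (A : ℝ) : Kernel (Cube d) (Cube d) where
  toFun := gibbsStep C A
  measurable' := measurable_gibbsStep C A

/-- `γ` is a coupling of `μ` and `ν`. -/
def IsCoupling {X : Type*} [MeasurableSpace X] (μ ν : Measure X) (γ : Measure (X × X)) : Prop :=
  γ.map Prod.fst = μ ∧ γ.map Prod.snd = ν

/-- The Wasserstein distance `inf E ‖p - q‖_∞` on measures on `[0,1]^d`, the infimum being over all
couplings of `p ∼ μ` and `q ∼ ν`; `edist` on `Cube d` is the sup-norm distance. -/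
def dInfty {d : ℕ} (μ ν : Measure (Cube d)) : ℝ≥0∞ :=
  ⨅ (γ : Measure (Cube d × Cube d)) (_ : IsCoupling μ ν γ), ∫⁻ z, edist z.1 z.2 ∂γ

end GibbsSampler

end

open GibbsSampler

/-! Conditionally on the other coordinates, coordinate `i` is a Gaussian truncated to the unit
interval, with parameters `A² deg C i` and `A² field C i`. Two integrations by parts give all that
is needed about this law: a bound on `E[x (b x - a)]`, and the fact that `b` times the mean is
1-Lipschitz in `a`.

Lower bound. Start at the corner `0` and follow `∑ deg_j q_j²`. Resampling is averaging over
neighbours plus noise of variance of order `A⁻²`; since the degree weights balance the averaging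
exactly, this sum grows in mean by at most `A⁻²` per step (`gibbsMean_sum_sq_le`). Up to a small
multiple of `A²` steps a non-isolated coordinate thus has mean at most 1/4, whereas by reflection
its stationary mean is 1/2.

Upper bound. All starting points can be run with common randomness so that order is preserved, and
every trajectory stays between those from `0` and `1`. It suffices to make the oscillation `h_k 1 -
h_k 0` small, where `h_k` is the mean of a coordinate after `k` steps (`dInfty_le_sum`). Each step
lowers the stationary second moment of `h_k` by a Dirichlet form, so before time `T` there is a
moment when this form is at most `d / T` (`exists_dirichlet_le`).

A small Dirichlet form forces a small oscillation (`sq_oscillation_le`). From a set of low-energy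
points near `0` on a connected component `S`, move to points near `1` on `S` by about `A` shifts of
size about `1/A`, each made one coordinate at a time. The path keeps `A²` times the energy bounded,
so the stationary density controls Lebesgue measure along it, and Cauchy-Schwarz over the path costs
a factor of order `A²`: this is the time scale. The starting set carries a fixed fraction of the
mass, because the energy concentrates and is invariant under shifts along `S`. Finally `h_k` near a
corner is compared with its value at the corner by a Lipschitz bound that the sampler preserves
(`gibbsMean_coord_regular`). The oscillation is nonincreasing in time, so one good moment is enough.
-/

noncomputable section

namespace GibbsSampler

/-! ### Gaussian distributions truncated to the unit interval -/

/-- The unnormalized density `exp (2 a x - b x²)`. -/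
def gaussWeight (b a x : ℝ) : ℝ := Real.exp (2 * a * x - b * x ^ 2)

/-- The probability measure on `[0,1]` with density proportional to `exp (2 a x - b x²)`. -/
def truncGauss (b a : ℝ) : Measure unitInterval :=
  (volume : Measure unitInterval).tilted (fun x => 2 * a * x - b * (x : ℝ) ^ 2)

/-- The normalizing constant of `truncGauss`. -/
def gaussMass (b a : ℝ) : ℝ := ∫ x : unitInterval, gaussWeight b a x

theorem integral_unitInterval_eq (f : ℝ → ℝ) :
    ∫ x : unitInterval, f x = ∫ x in (0 : ℝ)..1, f x := by
  rw [intervalIntegral.integral_of_le zero_le_one, ← integral_Icc_eq_integral_Ioc]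
  exact integral_subtype_comap measurableSet_Icc f

theorem continuous_gaussWeight (b a : ℝ) : Continuous (gaussWeight b a) := by
  unfold gaussWeight; fun_prop

theorem gaussWeight_pos (b a x : ℝ) : 0 < gaussWeight b a x := Real.exp_pos _

theorem integrable_of_continuous {X : Type*} [TopologicalSpace X] [CompactSpace X]
    [T2Space X] [MeasurableSpace X] [BorelSpace X] {μ : Measure X} [IsFiniteMeasure μ]
    {f : X → ℝ} (hf : Continuous f) : Integrable f μ := by
  have := hf.continuousOn.integrableOn_compact (μ := μ) isCompact_univ
  simpa using this

theorem integrable_gaussWeight (b a : ℝ) :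
    Integrable (fun x : unitInterval => gaussWeight b a x) :=
  integrable_of_continuous ((continuous_gaussWeight b a).comp continuous_subtype_val)

theorem gaussMass_pos (b a : ℝ) : 0 < gaussMass b a :=
  integral_exp_pos (integrable_gaussWeight b a)

instance (b a : ℝ) : IsProbabilityMeasure (truncGauss b a) :=
  isProbabilityMeasure_tilted (integrable_gaussWeight b a)

theorem integral_truncGauss (b a : ℝ) (f : unitInterval → ℝ) :
    ∫ x, f x ∂truncGauss b a = (∫ x : unitInterval, f x * gaussWeight b a x) / gaussMass b a := by
  rw [truncGauss, integral_tilted, ← integral_div]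
  refine integral_congr_ae (Filter.Eventually.of_forall fun x => ?_)
  simp only [smul_eq_mul, gaussMass, gaussWeight]
  ring

theorem hasDerivAt_gaussWeight (b a x : ℝ) :
    HasDerivAt (gaussWeight b a) (2 * (a - b * x) * gaussWeight b a x) x := by
  have h : HasDerivAt (fun x : ℝ => 2 * a * x - b * x ^ 2) (2 * a - b * (2 * x)) x := by
    have h1 : HasDerivAt (fun x : ℝ => 2 * a * x) (2 * a) x := by
      simpa using (hasDerivAt_id x).const_mul (2 * a)
    have h2 : HasDerivAt (fun x : ℝ => b * x ^ 2) (b * (2 * x)) x := by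
      simpa using (hasDerivAt_pow 2 x).const_mul b
    exact h1.fun_sub h2
  have h' := h.exp
  have e : 2 * (a - b * x) * gaussWeight b a x =
      Real.exp (2 * a * x - b * x ^ 2) * (2 * a - b * (2 * x)) := by
    rw [gaussWeight]; ring
  rw [e]
  exact h'

/-- Integration by parts for the first moment. -/
theorem gauss_mean_identity (b a : ℝ) :
    a - b * ∫ x, (x : ℝ) ∂truncGauss b a =
      (gaussWeight b a 1 - gaussWeight b a 0) / (2 * gaussMass b a) := by
  have hZ := gaussMass_pos b a
  have key : ∫ x in (0 : ℝ)..1, 2 * (a - b * x) * gaussWeight b a x =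
      gaussWeight b a 1 - gaussWeight b a 0 :=
    intervalIntegral.integral_eq_sub_of_hasDerivAt
      (fun x _ => hasDerivAt_gaussWeight b a x)
      (Continuous.intervalIntegrable (by have := continuous_gaussWeight b a; fun_prop) _ _)
  rw [← key, ← integral_unitInterval_eq, integral_truncGauss]
  have h1 : ∫ x : unitInterval, 2 * (a - b * x) * gaussWeight b a x =
      2 * a * gaussMass b a - 2 * b * ∫ x : unitInterval, (x : ℝ) * gaussWeight b a x := by
    have hc : Continuous fun x : unitInterval => gaussWeight b a x :=
      (continuous_gaussWeight b a).comp continuous_subtype_val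
    rw [gaussMass, ← integral_const_mul, ← integral_const_mul, ← integral_sub]
    · congr 1; ext x; ring
    · exact integrable_of_continuous (by fun_prop)
    · exact integrable_of_continuous (by fun_prop)
  rw [h1]; field_simp

/-- Integration by parts for the second moment. -/
theorem gauss_second_moment_le (b a : ℝ) :
    ∫ x, (x : ℝ) * (b * x - a) ∂truncGauss b a ≤ 1 / 2 := by
  have hZ := gaussMass_pos b a
  have hd : ∀ x : ℝ, HasDerivAt (fun x => x * gaussWeight b a x)
      (gaussWeight b a x - 2 * (x * (b * x - a) * gaussWeight b a x)) x := fun x => by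
    have h := (hasDerivAt_id' x).fun_mul (hasDerivAt_gaussWeight b a x)
    have e : gaussWeight b a x - 2 * (x * (b * x - a) * gaussWeight b a x) =
        1 * gaussWeight b a x + x * (2 * (a - b * x) * gaussWeight b a x) := by ring
    rw [e]
    exact h
  have hcont := continuous_gaussWeight b a
  have key : ∫ x in (0 : ℝ)..1, (gaussWeight b a x - 2 * (x * (b * x - a) * gaussWeight b a x)) =
      gaussWeight b a 1 := by
    rw [intervalIntegral.integral_eq_sub_of_hasDerivAt (fun x _ => hd x)
      (Continuous.intervalIntegrable (by fun_prop) _ _)]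
    simp
  rw [← integral_unitInterval_eq] at key
  have hc : Continuous fun x : unitInterval => gaussWeight b a x :=
      hcont.comp continuous_subtype_val
  rw [integral_sub (integrable_of_continuous hc) (integrable_of_continuous (by fun_prop)),
    integral_const_mul] at key
  rw [integral_truncGauss, div_le_div_iff₀ hZ (by norm_num)]
  -- The only loss is the boundary term at 1, which has a favourable sign.
  have := gaussWeight_pos b a 1
  change gaussMass b a - _ = _ at key
  linarith

/-- By `gauss_mean_identity`, `a - b * mean` is half the difference of the normalized densities at 1
and at 0. Raising `a` raises the former and lowers the latter, so truncation never makes the mean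
more sensitive to `a` than it is for a full Gaussian. -/
theorem gauss_mean_sub_le (b : ℝ) {a₁ a₂ : ℝ} (h : a₁ ≤ a₂) :
    b * (∫ x, (x : ℝ) ∂truncGauss b a₂) - b * (∫ x, (x : ℝ) ∂truncGauss b a₁) ≤ a₂ - a₁ := by
  have h1 := gauss_mean_identity b a₁
  have h2 := gauss_mean_identity b a₂
  have hZ₁ := gaussMass_pos b a₁
  have hZ₂ := gaussMass_pos b a₂
  have e0 : gaussWeight b a₂ 0 / gaussMass b a₂ ≤ gaussWeight b a₁ 0 / gaussMass b a₁ := by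
    have : gaussMass b a₁ ≤ gaussMass b a₂ := by
      refine integral_mono (integrable_gaussWeight b a₁) (integrable_gaussWeight b a₂) fun x => ?_
      refine Real.exp_le_exp.2 ?_
      have := mul_le_mul_of_nonneg_right h x.2.1
      linarith
    have h0 : ∀ a, gaussWeight b a 0 = 1 := fun a => by simp [gaussWeight]
    rw [h0, h0]
    exact one_div_le_one_div_of_le hZ₁ this
  have e1 : gaussWeight b a₁ 1 / gaussMass b a₁ ≤ gaussWeight b a₂ 1 / gaussMass b a₂ := by
    rw [div_le_div_iff₀ hZ₁ hZ₂, gaussMass, gaussMass, ← integral_const_mul, ← integral_const_mul]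
    refine integral_mono ((integrable_gaussWeight b a₂).const_mul _)
      ((integrable_gaussWeight b a₁).const_mul _) fun x => ?_
    simp only [gaussWeight, ← Real.exp_add]
    refine Real.exp_le_exp.2 ?_
    have := mul_le_mul_of_nonneg_right h (sub_nonneg.2 x.2.2)
    nlinarith
  have k1 : (gaussWeight b a₁ 1 - gaussWeight b a₁ 0) / (2 * gaussMass b a₁) =
      (gaussWeight b a₁ 1 / gaussMass b a₁ - gaussWeight b a₁ 0 / gaussMass b a₁) / 2 := by
    field_simp
  have k2 : (gaussWeight b a₂ 1 - gaussWeight b a₂ 0) / (2 * gaussMass b a₂) =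
      (gaussWeight b a₂ 1 / gaussMass b a₂ - gaussWeight b a₂ 0 / gaussMass b a₂) / 2 := by
    field_simp
  linarith

theorem truncGauss_real_apply (b a : ℝ) {s : Set unitInterval} (hs : MeasurableSet s) :
    (truncGauss b a).real s = (∫ x : unitInterval in s, gaussWeight b a x) / gaussMass b a := by
  rw [← integral_indicator_one hs, integral_truncGauss, ← integral_indicator hs]
  congr 2; ext x
  by_cases hx : x ∈ s <;> simp [hx]

/-- The distribution function decreases as the distribution moves to the right. -/
theorem truncGauss_Iic_antitone (b : ℝ) (x : unitInterval) :
    Antitone fun a => (truncGauss b a).real (Set.Iic x) := by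
  intro a₁ a₂ h
  simp only [truncGauss_real_apply _ _ measurableSet_Iic]
  have split : ∀ a, gaussMass b a = (∫ y : unitInterval in Set.Iic x, gaussWeight b a y) +
      ∫ y : unitInterval in Set.Ioi x, gaussWeight b a y := fun a => by
    rw [gaussMass, ← Set.compl_Iic]
    exact (integral_add_compl measurableSet_Iic (integrable_gaussWeight b a)).symm
  have hI := integrable_gaussWeight b
  set L : ℝ → ℝ := fun a => ∫ y : unitInterval in Set.Iic x, gaussWeight b a y
  set R : ℝ → ℝ := fun a => ∫ y : unitInterval in Set.Ioi x, gaussWeight b a y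
  have hL0 : ∀ a, 0 ≤ L a := fun a => integral_nonneg fun y => (gaussWeight_pos b a y).le
  have hR0 : ∀ a, 0 ≤ R a := fun a => integral_nonneg fun y => (gaussWeight_pos b a y).le
  -- The likelihood ratio `exp (2 (a₂ - a₁) y)` increases with `y`; comparing it with its value at
  -- `x` on either side of `x` gives both bounds.
  have hL : L a₂ ≤ Real.exp (2 * (a₂ - a₁) * x) * L a₁ := by
    simp only [L]
    rw [← integral_const_mul]
    refine setIntegral_mono_on (hI a₂).integrableOn ((hI a₁).const_mul _).integrableOn
      measurableSet_Iic fun y hy => ?_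
    simp only [gaussWeight, ← Real.exp_add]
    refine Real.exp_le_exp.2 ?_
    have hy' : (y : ℝ) ≤ x := hy
    nlinarith
  have hR : Real.exp (2 * (a₂ - a₁) * x) * R a₁ ≤ R a₂ := by
    simp only [R]
    rw [← integral_const_mul]
    refine setIntegral_mono_on ((hI a₁).const_mul _).integrableOn (hI a₂).integrableOn
      measurableSet_Ioi fun y hy => ?_
    simp only [gaussWeight, ← Real.exp_add]
    refine Real.exp_le_exp.2 ?_
    have hy' : (x : ℝ) ≤ y := le_of_lt hy
    nlinarith
  change L a₂ / _ ≤ L a₁ / _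
  rw [div_le_div_iff₀ (gaussMass_pos b a₂) (gaussMass_pos b a₁), split, split]
  change L a₂ * (L a₁ + R a₁) ≤ L a₁ * (L a₂ + R a₂)
  have := mul_le_mul_of_nonneg_right hL (hR0 a₁)
  have := mul_le_mul_of_nonneg_left hR (hL0 a₁)
  nlinarith

/-! ### Quantile functions, for a monotone coupling of truncated Gaussians -/

/-- The quantile function of `truncGauss`. -/
def gaussQuantile (b a : ℝ) (u : unitInterval) : unitInterval :=
  sInf {x | (u : ℝ) ≤ (truncGauss b a).real (Set.Iic x)}

/-- Right-continuity of the distribution function makes the infimum attained, hence a Galois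
connection. Monotonicity, joint measurability and the law of the quantile function all follow from
it. -/
theorem gaussQuantile_le_iff (b a : ℝ) (u x : unitInterval) :
    gaussQuantile b a u ≤ x ↔ (u : ℝ) ≤ (truncGauss b a).real (Set.Iic x) := by
  set S := {x | (u : ℝ) ≤ (truncGauss b a).real (Set.Iic x)} with hS
  have hne : S.Nonempty := ⟨1, by
    have : Set.Iic (1 : unitInterval) = Set.univ := Set.eq_univ_of_forall fun x => x.2.2
    simp [hS, this, u.2.2]⟩
  have hmem : sInf S ∈ S := by
    obtain ⟨v, hv, hlim, hvS⟩ := exists_seq_tendsto_sInf hne (OrderBot.bddBelow S)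
    have hset : ⋂ n, Set.Iic (v n) = Set.Iic (sInf S) := by
      ext y
      simp only [Set.mem_iInter, Set.mem_Iic]
      exact ⟨fun h => ge_of_tendsto' hlim h, fun h n => h.trans (hv.le_of_tendsto hlim n)⟩
    have ht := tendsto_measure_iInter_atTop (μ := truncGauss b a) (s := fun n => Set.Iic (v n))
      (fun n => measurableSet_Iic.nullMeasurableSet)
      (fun i j hij => Set.Iic_subset_Iic.2 (hv hij)) ⟨0, measure_ne_top _ _⟩
    rw [hset] at ht
    exact ge_of_tendsto' ((ENNReal.tendsto_toReal (measure_ne_top _ _)).comp ht) hvS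
  refine ⟨fun h => le_trans hmem ?_, fun h => sInf_le h⟩
  exact measureReal_mono (Set.Iic_subset_Iic.2 h)

theorem gaussQuantile_mono (b : ℝ) (u : unitInterval) :
    Monotone fun a => gaussQuantile b a u := by
  intro a₁ a₂ h
  change gaussQuantile b a₁ u ≤ gaussQuantile b a₂ u
  rw [gaussQuantile_le_iff]
  exact ((gaussQuantile_le_iff b a₂ u _).1 le_rfl).trans (truncGauss_Iic_antitone b _ h)

theorem measurable_gaussQuantile (b : ℝ) :
    Measurable fun z : ℝ × unitInterval => gaussQuantile b z.1 z.2 := by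
  refine measurable_of_Iic fun x => ?_
  have : (fun z : ℝ × unitInterval => gaussQuantile b z.1 z.2) ⁻¹' Set.Iic x =
      {z | (z.2 : ℝ) ≤ (truncGauss b z.1).real (Set.Iic x)} := by
    ext z; exact gaussQuantile_le_iff b z.1 z.2 x
  rw [this]
  exact measurableSet_le (measurable_subtype_coe.comp measurable_snd)
    ((truncGauss_Iic_antitone b x).measurable.comp measurable_fst)

theorem map_gaussQuantile (b a : ℝ) :
    (volume : Measure unitInterval).map (gaussQuantile b a) = truncGauss b a := by
  have hm : Measurable (gaussQuantile b a) :=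
    (measurable_gaussQuantile b).comp (measurable_const.prodMk measurable_id)
  have := Measure.isProbabilityMeasure_map (μ := (volume : Measure unitInterval)) hm.aemeasurable
  refine Measure.ext_of_Iic _ _ fun x => ?_
  rw [Measure.map_apply hm measurableSet_Iic]
  let t : unitInterval := ⟨(truncGauss b a).real (Set.Iic x), measureReal_nonneg,
    measureReal_le_one⟩
  have : gaussQuantile b a ⁻¹' Set.Iic x = Set.Iic t := by
    ext u; exact gaussQuantile_le_iff b a u x
  rw [this, unitInterval.volume_Iic]
  exact ofReal_measureReal

/-! ### The energy as a quadratic form on `ℝ^d` -/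

variable {d : ℕ}

/-- The total weight at a vertex. -/
def deg (C : Network d) (i : Fin d) : ℝ := ∑ j, C.weight i j

/-- The weighted sum of the values at the neighbours of a vertex. -/
def field (C : Network d) (i : Fin d) (x : Fin d → ℝ) : ℝ := ∑ j, C.weight i j * x j

/-- The energy as a function on `ℝ^d`. -/
def quadEnergy (C : Network d) (x : Fin d → ℝ) : ℝ :=
  (∑ i, ∑ j, C.weight i j * (x i - x j) ^ 2) / 2

/-- The point of the cube as a vector of `ℝ^d`. -/
def toVec (p : Cube d) : Fin d → ℝ := fun i => (p i : ℝ)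

theorem deg_nonneg (C : Network d) (i : Fin d) : 0 ≤ deg C i :=
  Finset.sum_nonneg fun j _ => C.nonneg i j

theorem energy_eq_quadEnergy (C : Network d) (p : Cube d) :
    energy C p = quadEnergy C (toVec p) := by
  have h := Finset.sum_sum_Ioi_add_eq_sum_sum_off_diag
    (fun i j => C.weight i j * ((p i : ℝ) - p j) ^ 2)
  have h1 : ∀ i j : Fin d, C.weight j i * ((p j : ℝ) - p i) ^ 2 +
      C.weight i j * ((p i : ℝ) - p j) ^ 2 = 2 * (C.weight i j * ((p i : ℝ) - p j) ^ 2) := by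
    intro i j; rw [C.symm j i]; ring
  simp only [h1, ← Finset.mul_sum] at h
  have h2 : ∀ i : Fin d, ∑ j ∈ ({i}ᶜ : Finset (Fin d)), C.weight j i * ((p j : ℝ) - p i) ^ 2 =
      ∑ j, C.weight i j * ((p i : ℝ) - p j) ^ 2 := by
    intro i
    have := Finset.sum_compl_add_sum {i} (fun j => C.weight j i * ((p j : ℝ) - p i) ^ 2)
    simp only [Finset.sum_singleton, sub_self, ne_eq, OfNat.ofNat_ne_zero, not_false_eq_true,
      zero_pow, mul_zero, add_zero] at this
    rw [this]
    refine Finset.sum_congr rfl fun j _ => ?_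
    rw [C.symm j i]; ring
  simp only [h2] at h
  simp only [energy, quadEnergy, toVec, ← h]
  ring

theorem quadEnergy_nonneg (C : Network d) (x : Fin d → ℝ) : 0 ≤ quadEnergy C x :=
  div_nonneg (Finset.sum_nonneg fun i _ => Finset.sum_nonneg fun j _ =>
    mul_nonneg (C.nonneg i j) (sq_nonneg _)) zero_le_two

theorem energy_nonneg (C : Network d) (p : Cube d) : 0 ≤ energy C p :=
  energy_eq_quadEnergy C p ▸ quadEnergy_nonneg C _

theorem continuous_quadEnergy (C : Network d) : Continuous (quadEnergy C) := by
  unfold quadEnergy; fun_prop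

theorem continuous_toVec : Continuous (toVec (d := d)) := by
  unfold toVec; fun_prop

theorem continuous_energy (C : Network d) : Continuous (energy C) := by
  rw [show energy C = quadEnergy C ∘ toVec from funext (energy_eq_quadEnergy C)]
  exact (continuous_quadEnergy C).comp continuous_toVec

theorem continuous_field (C : Network d) (i : Fin d) : Continuous (field C i) := by
  unfold field; fun_prop

theorem field_mono (C : Network d) (i : Fin d) : Monotone (field C i) := fun _ _ h =>
  Finset.sum_le_sum fun j _ => mul_le_mul_of_nonneg_left (h j) (C.nonneg i j)

theorem field_update (C : Network d) (i : Fin d) (x : Fin d → ℝ) (t : ℝ) :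
    field C i (Function.update x i t) = field C i x := by
  refine Finset.sum_congr rfl fun j _ => ?_
  by_cases h : j = i
  · subst h; simp [C.loopless]
  · simp [h]

/-- Discrete Green identity. It splits the energy into one term per vertex, each of the form
controlled by `gauss_second_moment_le`. -/
theorem sum_deg_mul_sub_field (C : Network d) (x : Fin d → ℝ) :
    ∑ i, x i * (deg C i * x i - field C i x) = quadEnergy C x := by
  have h1 : ∑ i, x i * (deg C i * x i - field C i x) =
      ∑ i, ∑ j, C.weight i j * (x i * (x i - x j)) := by
    refine Finset.sum_congr rfl fun i _ => ?_
    rw [deg, field, Finset.sum_mul, ← Finset.sum_sub_distrib, Finset.mul_sum]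
    exact Finset.sum_congr rfl fun j _ => by ring
  have h2 : ∑ i, ∑ j, C.weight i j * (x i * (x i - x j)) =
      ∑ i, ∑ j, C.weight i j * (x j * (x j - x i)) := by
    rw [Finset.sum_comm]
    exact Finset.sum_congr rfl fun i _ => Finset.sum_congr rfl fun j _ => by rw [C.symm]
  have h3 : ∑ i, ∑ j, C.weight i j * (x i - x j) ^ 2 =
      ∑ i, ∑ j, C.weight i j * (x i * (x i - x j)) +
      ∑ i, ∑ j, C.weight i j * (x j * (x j - x i)) := by
    simp only [← Finset.sum_add_distrib]
    exact Finset.sum_congr rfl fun i _ => Finset.sum_congr rfl fun j _ => by ring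
  rw [quadEnergy, h3, ← h2, h1]; ring

/-- As a polynomial in one coordinate the energy has leading coefficient `deg` and linear
coefficient `-2 field`; this is what identifies the conditional laws as truncated Gaussians. -/
theorem quadEnergy_update (C : Network d) (i : Fin d) (x : Fin d → ℝ) (t : ℝ) :
    quadEnergy C (Function.update x i t) =
      quadEnergy C (Function.update x i 0) + (deg C i * t ^ 2 - 2 * field C i x * t) := by
  set y := Function.update x i 0 with hy
  have hyi : y i = 0 := by simp [hy]
  have hfy : field C i x = field C i y := (field_update C i x 0).symm
  let e : Fin d → ℝ := Pi.single i 1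
  have he : ∀ k, e k ^ 2 = e k := fun k => by
    by_cases h : k = i
    · subst h; simp [e]
    · simp [e, h]
  have hu : Function.update x i t = fun k => y k + t * e k := by
    ext k
    by_cases h : k = i
    · subst h; simp [e, hyi]
    · simp [e, h, hy]
  -- The cross terms of the perturbation vanish because there are no loops.
  have hee : ∀ k l, C.weight k l * (e k * e l) = 0 := fun k l => by
    by_cases h : k = i
    · by_cases h' : l = i
      · subst h; subst h'; simp [C.loopless]
      · simp [e, h']
    · simp [e, h]
  have expand : ∀ k l, C.weight k l * ((y k + t * e k) - (y l + t * e l)) ^ 2 =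
      C.weight k l * (y k - y l) ^ 2 +
      (e k * (C.weight k l * (2 * t * (y k - y l) + t ^ 2)) +
        e l * (C.weight k l * (2 * t * (y l - y k) + t ^ 2))) := fun k l => by
    linear_combination C.weight k l * t ^ 2 * (he k) + C.weight k l * t ^ 2 * (he l) -
      2 * t ^ 2 * hee k l
  have pick : ∀ f : Fin d → ℝ, ∑ k, e k * f k = f i := fun f => by
    simp [e, Pi.single_apply]
  have s1 : ∑ k, ∑ l, e k * (C.weight k l * (2 * t * (y k - y l) + t ^ 2)) =
      deg C i * t ^ 2 - 2 * field C i y * t := by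
    simp only [← Finset.mul_sum]
    rw [pick, deg, field, hyi, Finset.sum_mul, Finset.mul_sum, Finset.sum_mul,
      ← Finset.sum_sub_distrib]
    exact Finset.sum_congr rfl fun l _ => by ring
  have s2 : ∑ k, ∑ l, e l * (C.weight k l * (2 * t * (y l - y k) + t ^ 2)) =
      deg C i * t ^ 2 - 2 * field C i y * t := by
    rw [← s1, Finset.sum_comm]
    exact Finset.sum_congr rfl fun k _ => Finset.sum_congr rfl fun l _ => by rw [C.symm]
  rw [hu, hfy]
  simp only [quadEnergy, expand, Finset.sum_add_distrib, s1, s2]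
  ring

theorem toVec_update (p : Cube d) (i : Fin d) (x : unitInterval) :
    toVec (Function.update p i x) = Function.update (toVec p) i (x : ℝ) := by
  ext k
  by_cases h : k = i
  · subst h; simp [toVec]
  · simp [toVec, h]

theorem measurable_toVec : Measurable (toVec (d := d)) := continuous_toVec.measurable

theorem coordConditional_eq (C : Network d) (A : ℝ) (i : Fin d) (p : Cube d) :
    coordConditional C A i p = truncGauss (A ^ 2 * deg C i) (A ^ 2 * field C i (toVec p)) := by
  have h : ∀ x : unitInterval, Real.exp (-A ^ 2 * energy C (Function.update p i x)) =
      Real.exp (-A ^ 2 * quadEnergy C (Function.update (toVec p) i 0)) *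
      Real.exp (2 * (A ^ 2 * field C i (toVec p)) * x - (A ^ 2 * deg C i) * (x : ℝ) ^ 2) := by
    intro x
    rw [energy_eq_quadEnergy, toVec_update, quadEnergy_update, ← Real.exp_add]
    congr 1; ring
  simp only [coordConditional, truncGauss, Measure.tilted, h, integral_const_mul]
  congr 1; ext x
  rw [mul_div_mul_left _ _ (Real.exp_pos _).ne']

/-! ### One step of the sampler as a random monotone map -/

/-- Resampling of the coordinate `i`, driven by a uniform variable. -/
def stepMap (C : Network d) (A : ℝ) (i : Fin d) (p : Cube d) (u : unitInterval) : Cube d :=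
  Function.update p i (gaussQuantile (A ^ 2 * deg C i) (A ^ 2 * field C i (toVec p)) u)

theorem measurable_stepMap (C : Network d) (A : ℝ) (i : Fin d) :
    Measurable fun z : Cube d × unitInterval => stepMap C A i z.1 z.2 := by
  have h1 : Measurable fun z : Cube d × unitInterval =>
      gaussQuantile (A ^ 2 * deg C i) (A ^ 2 * field C i (toVec z.1)) z.2 :=
    (measurable_gaussQuantile (A ^ 2 * deg C i)).comp
      ((((continuous_field C i).measurable.comp (measurable_toVec.comp measurable_fst)).const_mul
        (A ^ 2)).prodMk measurable_snd)
  exact measurable_update'.comp (measurable_fst.prodMk h1)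

theorem measurable_stepMap_right (C : Network d) (A : ℝ) (i : Fin d) (p : Cube d) :
    Measurable (stepMap C A i p) :=
  (measurable_stepMap C A i).comp (measurable_const.prodMk measurable_id)

theorem toVec_mono : Monotone (toVec (d := d)) := fun _ _ h i => h i

/-- Nonnegative weights make the field increasing in the configuration, and the quantile is
increasing in the field. -/
theorem stepMap_mono (C : Network d) (A : ℝ) (i : Fin d) (u : unitInterval) :
    Monotone fun p => stepMap C A i p u := by
  intro p q h
  refine update_le_update_iff.2 ⟨gaussQuantile_mono _ _ ?_, fun j _ => h j⟩
  exact mul_le_mul_of_nonneg_left (field_mono C i (toVec_mono h)) (sq_nonneg A)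

theorem stepMap_update (C : Network d) (A : ℝ) (i : Fin d) (p : Cube d) (x u : unitInterval) :
    stepMap C A i (Function.update p i x) u = stepMap C A i p u := by
  simp [stepMap, toVec_update, field_update]

theorem map_gaussQuantile_eq (C : Network d) (A : ℝ) (i : Fin d) (p : Cube d) :
    volume.map (gaussQuantile (A ^ 2 * deg C i) (A ^ 2 * field C i (toVec p))) =
      coordConditional C A i p := by
  rw [coordConditional_eq, map_gaussQuantile]

theorem map_stepMap (C : Network d) (A : ℝ) (i : Fin d) (p : Cube d) :
    (volume : Measure unitInterval).map (stepMap C A i p) =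
      (coordConditional C A i p).map (Function.update p i) := by
  have hm : Measurable (gaussQuantile (A ^ 2 * deg C i) (A ^ 2 * field C i (toVec p))) :=
    (measurable_gaussQuantile _).comp (measurable_const.prodMk measurable_id)
  rw [← map_gaussQuantile_eq, Measure.map_map (measurable_update p) hm]
  rfl

theorem gibbsKernel_apply (C : Network d) (A : ℝ) (p : Cube d) :
    gibbsKernel C A p =
      ∑ i : Fin d, (d : ℝ≥0∞)⁻¹ • (volume : Measure unitInterval).map (stepMap C A i p) := by
  simp only [map_stepMap]; rfl

theorem isMarkovKernel_gibbsKernel (C : Network d) (A : ℝ) (hd : d ≠ 0) :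
    IsMarkovKernel (gibbsKernel C A) := by
  refine ⟨fun p => ⟨?_⟩⟩
  rw [gibbsKernel_apply]
  simp only [Measure.coe_finsetSum, Finset.sum_apply, Measure.smul_apply, smul_eq_mul]
  have : ∀ i, (volume : Measure unitInterval).map (stepMap C A i p) Set.univ = 1 := fun i => by
    rw [Measure.map_apply (measurable_stepMap_right C A i p) MeasurableSet.univ]; simp
  simp only [this, mul_one, Finset.sum_const, Finset.card_univ, Fintype.card_fin, nsmul_eq_mul]
  exact ENNReal.mul_inv_cancel (by simpa using hd) (ENNReal.natCast_ne_top d)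

/-! ### Invariance of the stationary measure -/

theorem integrable_exp_energy (C : Network d) (A : ℝ) :
    Integrable (fun p : Cube d => Real.exp (-A ^ 2 * energy C p)) :=
  integrable_of_continuous (by have := continuous_energy C; fun_prop)

instance (C : Network d) (A : ℝ) : IsProbabilityMeasure (stationary C A) :=
  isProbabilityMeasure_tilted (integrable_exp_energy C A)

theorem lintegral_eq_lintegral_update (i : Fin d) {f : Cube d → ℝ≥0∞} (hf : Measurable f) :
    ∫⁻ p, f p = ∫⁻ p : Cube d, ∫⁻ x : unitInterval, f (Function.update p i x) := by
  have hg : Measurable fun p : Cube d => ∫⁻ x : unitInterval, f (Function.update p i x) :=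
    Measurable.lintegral_prod_right' (f := fun z : Cube d × unitInterval =>
      f (Function.update z.1 i z.2)) (hf.comp measurable_update')
  refine lintegral_eq_of_lmarginal_eq (μ := fun _ => (volume : Measure unitInterval)) {i} hf hg ?_
  rw [lmarginal_singleton, lmarginal_singleton]
  ext p
  simp

/-- Disintegrate along lines parallel to the `i`-th axis: the step forgets its position on the line
and draws a new one from the normalized restriction of the density to that line. -/
theorem measurePreserving_stepMap (C : Network d) (A : ℝ) (i : Fin d) :
    MeasurePreserving (fun z : Cube d × unitInterval => stepMap C A i z.1 z.2)
      ((stationary C A).prod volume) (stationary C A) := by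
  refine ⟨measurable_stepMap C A i, Measure.ext_of_lintegral _ fun F hF => ?_⟩
  rw [lintegral_map hF (measurable_stepMap C A i),
    lintegral_prod (fun z : Cube d × unitInterval => F (stepMap C A i z.1 z.2))
      (hF.comp (measurable_stepMap C A i)).aemeasurable]
  set ρ : Cube d → ℝ := fun p => Real.exp (-A ^ 2 * energy C p) with hρ
  set Z : ℝ := ∫ p, ρ p
  have hZ : 0 < Z := integral_exp_pos (integrable_exp_energy C A)
  have hρm : Measurable ρ := ((measurable_energy C).const_mul _).exp
  let Zi : Cube d → ℝ := fun p => ∫ x : unitInterval, ρ (Function.update p i x)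
  have hρi : ∀ p, Integrable fun x : unitInterval => ρ (Function.update p i x) := fun p =>
    integrable_of_continuous (by have := continuous_energy C; fun_prop)
  have hZi : ∀ p, 0 < Zi p := fun p => integral_exp_pos (hρi p)
  let W : Cube d → ℝ≥0∞ := fun p => ∫⁻ u : unitInterval, F (stepMap C A i p u)
  have hWm : Measurable W :=
    Measurable.lintegral_prod_right' (hF.comp (measurable_stepMap C A i))
  have hW : ∀ p, W p = ∫⁻ x : unitInterval, ENNReal.ofReal (ρ (Function.update p i x) / Zi p) *
      F (Function.update p i x) := fun p => by
    simp only [W]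
    rw [← lintegral_map hF (measurable_stepMap_right C A i p), map_stepMap,
      lintegral_map hF (measurable_update p), coordConditional, lintegral_tilted]
  rw [stationary, lintegral_tilted, lintegral_tilted]
  change ∫⁻ p, ENNReal.ofReal (ρ p / Z) * W p = ∫⁻ p, ENNReal.ofReal (ρ p / Z) * F p
  rw [lintegral_eq_lintegral_update i (by fun_prop),
    lintegral_eq_lintegral_update i (f := fun p => ENNReal.ofReal (ρ p / Z) * F p) (by fun_prop)]
  refine lintegral_congr fun p => ?_
  -- `W` is constant on each line, so integrating the density over the line produces the factor `Zi
  -- p / Z`, and `Zi p` cancels the conditional normalization.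
  have hWu : ∀ x, W (Function.update p i x) = W p := fun x => by
    simp only [W, stepMap_update]
  simp only [hWu]
  have hFm : Measurable fun x : unitInterval => F (Function.update p i x) :=
    hF.comp (measurable_update p)
  have hpm : Measurable fun x : unitInterval => ρ (Function.update p i x) :=
    hρm.comp (measurable_update p)
  rw [lintegral_mul_const _ (by fun_prop), ← ofReal_integral_eq_lintegral_ofReal
    ((hρi p).div_const _) (Filter.Eventually.of_forall fun x =>
      div_nonneg (Real.exp_pos _).le hZ.le), integral_div, hW,
    ← lintegral_const_mul _ (by fun_prop)]
  refine lintegral_congr fun x => ?_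
  rw [← mul_assoc, ← ENNReal.ofReal_mul (div_nonneg (hZi p).le hZ.le)]
  congr 2
  change Zi p / Z * _ = _
  field_simp [(hZi p).ne']

/-! ### The law after `k` steps -/

instance [NeZero d] (C : Network d) (A : ℝ) : IsMarkovKernel (gibbsKernel C A) :=
  isMarkovKernel_gibbsKernel C A (NeZero.ne d)

theorem gibbsKernel_pow_succ_apply (C : Network d) (A : ℝ) (k : ℕ) (p : Cube d) :
    (gibbsKernel C A ^ (k + 1)) p = (gibbsKernel C A p).bind (gibbsKernel C A ^ k) := by
  rw [pow_succ]
  exact Kernel.comp_apply _ _ _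

theorem gibbsKernel_pow_zero_apply (C : Network d) (A : ℝ) (p : Cube d) :
    (gibbsKernel C A ^ 0) p = Measure.dirac p := by
  rw [pow_zero]
  exact Kernel.id_apply p

theorem isMarkovKernel_gibbsKernel_pow [NeZero d] (C : Network d) (A : ℝ) (k : ℕ) :
    IsMarkovKernel (gibbsKernel C A ^ k) := by
  induction k with
  | zero => exact ⟨fun p => by rw [gibbsKernel_pow_zero_apply]; infer_instance⟩
  | succ k ih => rw [pow_succ]; exact inferInstanceAs (IsMarkovKernel (_ ∘ₖ _))

instance [NeZero d] (C : Network d) (A : ℝ) (k : ℕ) : IsMarkovKernel (gibbsKernel C A ^ k) :=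
  isMarkovKernel_gibbsKernel_pow C A k

theorem lintegral_gibbsKernel (C : Network d) (A : ℝ) (p : Cube d) {F : Cube d → ℝ≥0∞}
    (hF : Measurable F) :
    ∫⁻ q, F q ∂gibbsKernel C A p =
      ∑ i : Fin d, (d : ℝ≥0∞)⁻¹ * ∫⁻ u : unitInterval, F (stepMap C A i p u) := by
  rw [gibbsKernel_apply, lintegral_finsetSum_measure]
  refine Finset.sum_congr rfl fun i _ => ?_
  rw [lintegral_smul_measure, lintegral_map hF (measurable_stepMap_right C A i p), smul_eq_mul]

theorem stationary_bind_gibbsKernel [NeZero d] (C : Network d) (A : ℝ) :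
    (stationary C A).bind (gibbsKernel C A) = stationary C A := by
  refine Measure.ext_of_lintegral _ fun F hF => ?_
  rw [Measure.lintegral_bind (Kernel.aemeasurable _) hF.aemeasurable]
  simp only [lintegral_gibbsKernel C A _ hF]
  have hm : ∀ i, Measurable fun p : Cube d => ∫⁻ u : unitInterval, F (stepMap C A i p u) :=
    fun i => Measurable.lintegral_prod_right' (hF.comp (measurable_stepMap C A i))
  rw [lintegral_finsetSum _ fun i _ => (hm i).const_mul _]
  have : ∀ i, ∫⁻ p, ((d : ℝ≥0∞)⁻¹ * ∫⁻ u : unitInterval, F (stepMap C A i p u)) ∂stationary C A =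
      (d : ℝ≥0∞)⁻¹ * ∫⁻ p, F p ∂stationary C A := fun i => by
    rw [lintegral_const_mul _ (hm i)]
    conv_rhs => rw [← (measurePreserving_stepMap C A i).map_eq,
      lintegral_map hF (measurable_stepMap C A i),
      lintegral_prod (fun z : Cube d × unitInterval => F (stepMap C A i z.1 z.2))
        (hF.comp (measurable_stepMap C A i)).aemeasurable]
  rw [Finset.sum_congr rfl fun i _ => this i, Finset.sum_const, Finset.card_univ, Fintype.card_fin,
    nsmul_eq_mul, ← mul_assoc, ENNReal.mul_inv_cancel (by simpa using NeZero.ne d) (ENNReal.natCast_ne_top d),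
    one_mul]

theorem stationary_bind_gibbsKernel_pow [NeZero d] (C : Network d) (A : ℝ) (k : ℕ) :
    (stationary C A).bind (gibbsKernel C A ^ k) = stationary C A := by
  induction k with
  | zero =>
    rw [pow_zero]
    exact Measure.id_comp
  | succ k ih =>
    rw [pow_succ]
    exact Kernel.Invariant.comp (κ := gibbsKernel C A ^ k) ih (stationary_bind_gibbsKernel C A)

/-- The sampler run from all initial states with the same randomness, monotone in the initial
state. -/
theorem exists_monotone_random_map [NeZero d] (C : Network d) (A : ℝ) (k : ℕ) :
    ∃ (Ω : Type) (_ : MeasurableSpace Ω) (P : Measure Ω) (_ : IsProbabilityMeasure P)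
      (Φ : Cube d → Ω → Cube d), Measurable (fun z : Cube d × Ω => Φ z.1 z.2) ∧
      (∀ ω, Monotone fun p => Φ p ω) ∧ ∀ p, P.map (Φ p) = (gibbsKernel C A ^ k) p := by
  induction k with
  | zero =>
    refine ⟨Unit, inferInstance, Measure.dirac (), inferInstance, fun p _ => p, measurable_fst,
      fun _ => monotone_id, fun p => ?_⟩
    rw [gibbsKernel_pow_zero_apply]
    exact Measure.map_dirac' measurable_const ()
  | succ k ih =>
    obtain ⟨Ω, mΩ, P, hP, Φ, hΦm, hΦ, hlaw⟩ := ih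
    let ν : Measure (Fin d) := ∑ i : Fin d, (d : ℝ≥0∞)⁻¹ • Measure.dirac i
    have hν : IsProbabilityMeasure ν := ⟨by
      simp only [ν, Measure.coe_finsetSum, Finset.sum_apply, Measure.smul_apply, smul_eq_mul,
        measure_univ, mul_one, Finset.sum_const, Finset.card_univ, Fintype.card_fin, nsmul_eq_mul]
      exact ENNReal.mul_inv_cancel (by simpa using NeZero.ne d) (ENNReal.natCast_ne_top d)⟩
    have hstep : Measurable fun z : Cube d × (Fin d × unitInterval) =>
        stepMap C A z.2.1 z.1 z.2.2 := by
      have h : Measurable fun z : Fin d × (Cube d × unitInterval) =>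
          stepMap C A z.1 z.2.1 z.2.2 :=
        measurable_from_prod_countable_right fun i => measurable_stepMap C A i
      exact h.comp ((measurable_fst.comp measurable_snd).prodMk
        (measurable_fst.prodMk (measurable_snd.comp measurable_snd)))
    have hm : Measurable fun z : Cube d × ((Fin d × unitInterval) × Ω) =>
        Φ (stepMap C A z.2.1.1 z.1 z.2.1.2) z.2.2 :=
      hΦm.comp ((hstep.comp (measurable_fst.prodMk (measurable_fst.comp measurable_snd))).prodMk
        (measurable_snd.comp measurable_snd))
    -- The fresh step is made first and the old map `Φ` comes after it, in agreement with the
    -- decomposition at the first step in `gibbsKernel_pow_succ_apply`.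
    refine ⟨(Fin d × unitInterval) × Ω, inferInstance, (ν.prod volume).prod P, inferInstance,
      fun p z => Φ (stepMap C A z.1.1 p z.1.2) z.2, hm,
      fun z => (hΦ z.2).comp (stepMap_mono C A z.1.1 z.1.2), fun p => ?_⟩
    rw [gibbsKernel_pow_succ_apply]
    refine Measure.ext_of_lintegral _ fun F hF => ?_
    have hmp : Measurable fun z : (Fin d × unitInterval) × Ω =>
        Φ (stepMap C A z.1.1 p z.1.2) z.2 := hm.comp (measurable_const.prodMk measurable_id)
    have hΦq : ∀ q, Measurable (Φ q) := fun q => hΦm.comp (measurable_const.prodMk measurable_id)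
    have hG : Measurable fun q => ∫⁻ ω, F (Φ q ω) ∂P :=
      Measurable.lintegral_prod_right' (f := fun z : Cube d × Ω => F (Φ z.1 z.2)) (hF.comp hΦm)
    have hsp : Measurable fun z : Fin d × unitInterval => stepMap C A z.1 p z.2 :=
      hstep.comp (measurable_const.prodMk measurable_id)
    rw [lintegral_map hF hmp, lintegral_prod
        (fun z : (Fin d × unitInterval) × Ω => F (Φ (stepMap C A z.1.1 p z.1.2) z.2))
        (hF.comp hmp).aemeasurable,
      Measure.lintegral_bind (Kernel.aemeasurable _) hF.aemeasurable]
    have e : ∀ q, ∫⁻ x, F x ∂(gibbsKernel C A ^ k) q = ∫⁻ ω, F (Φ q ω) ∂P := fun q => by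
      rw [← hlaw, lintegral_map hF (hΦq q)]
    simp only [e]
    rw [lintegral_gibbsKernel C A p hG, lintegral_prod
      (fun z : Fin d × unitInterval => ∫⁻ ω, F (Φ (stepMap C A z.1 p z.2) ω) ∂P)
      (hG.comp hsp).aemeasurable, lintegral_finsetSum_measure]
    refine Finset.sum_congr rfl fun i _ => ?_
    rw [lintegral_smul_measure, lintegral_dirac, smul_eq_mul]

/-- The expectation of `h` after `k` steps from `p`. -/
def gibbsMean (C : Network d) (A : ℝ) (k : ℕ) (h : Cube d → ℝ) (p : Cube d) : ℝ :=
  ∫ q, h q ∂(gibbsKernel C A ^ k) p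

theorem cube_zero_le (p : Cube d) : 0 ≤ p := fun _ => unitInterval.nonneg'

theorem cube_le_one (p : Cube d) : p ≤ 1 := fun _ => unitInterval.le_one'

/-- The distance to stationarity is bounded by the distance of the mean states started from the two
extreme states. -/
theorem dInfty_le_sum [NeZero d] (C : Network d) (A : ℝ) (k : ℕ) (p : Cube d) :
    dInfty ((gibbsKernel C A ^ k) p) (stationary C A) ≤
      ∑ i, ENNReal.ofReal (gibbsMean C A k (fun q => (q i : ℝ)) 1 -
        gibbsMean C A k (fun q => (q i : ℝ)) 0) := by
  obtain ⟨Ω, mΩ, P, hP, Φ, hΦm, hΦ, hlaw⟩ := exists_monotone_random_map C A k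
  have hΦq : ∀ q, Measurable (Φ q) := fun q => hΦm.comp (measurable_const.prodMk measurable_id)
  have hpair : Measurable fun z : Cube d × Ω => (Φ p z.2, Φ z.1 z.2) :=
    ((hΦq p).comp measurable_snd).prodMk hΦm
  -- Draw one starting point from the stationary law and drive it and `p` by the same random map;
  -- invariance gives the second marginal.
  have hc : IsCoupling ((gibbsKernel C A ^ k) p) (stationary C A)
      (((stationary C A).prod P).map fun z => (Φ p z.2, Φ z.1 z.2)) := by
    constructor
    · rw [Measure.map_map measurable_fst hpair, ← hlaw]
      refine Measure.ext_of_lintegral _ fun F hF => ?_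
      rw [lintegral_map hF (measurable_fst.comp hpair), lintegral_map hF (hΦq p)]
      change ∫⁻ z : Cube d × Ω, F (Φ p z.2) ∂_ = _
      rw [lintegral_prod (fun z : Cube d × Ω => F (Φ p z.2))
        ((hF.comp ((hΦq p).comp measurable_snd)).aemeasurable)]
      simp
    · rw [Measure.map_map measurable_snd hpair]
      refine Measure.ext_of_lintegral _ fun F hF => ?_
      conv_rhs => rw [← stationary_bind_gibbsKernel_pow C A k]
      rw [lintegral_map hF (measurable_snd.comp hpair),
        Measure.lintegral_bind (Kernel.aemeasurable _) hF.aemeasurable]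
      change ∫⁻ z : Cube d × Ω, F (Φ z.1 z.2) ∂_ = _
      rw [lintegral_prod (fun z : Cube d × Ω => F (Φ z.1 z.2)) (hF.comp hΦm).aemeasurable]
      refine lintegral_congr fun q => ?_
      rw [← hlaw, lintegral_map hF (hΦq q)]
  refine (iInf₂_le _ hc).trans ?_
  rw [lintegral_map (measurable_edist) hpair]
  have hcoord : ∀ q i, Measurable fun ω => ((Φ q ω i : unitInterval) : ℝ) := fun q i =>
    measurable_subtype_coe.comp ((measurable_pi_apply i).comp (hΦq q))
  -- Both trajectories are squeezed between those from `0` and `1`. The gaps are nonnegative, so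
  -- their expectations are plain differences of means.
  have hpt : ∀ z : Cube d × Ω, edist (Φ p z.2) (Φ z.1 z.2) ≤
      ∑ i, ENNReal.ofReal ((Φ 1 z.2 i : ℝ) - Φ 0 z.2 i) := fun z => by
    refine edist_pi_le_iff.2 fun i => ?_
    refine le_trans ?_ (Finset.single_le_sum (f := fun i =>
      ENNReal.ofReal ((Φ 1 z.2 i : ℝ) - Φ 0 z.2 i)) (fun _ _ => zero_le) (Finset.mem_univ i))
    rw [edist_dist]
    refine ENNReal.ofReal_le_ofReal ?_
    rw [Subtype.dist_eq, Real.dist_eq, abs_le]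
    have a1 : (Φ 0 z.2 i : ℝ) ≤ Φ p z.2 i := hΦ z.2 (cube_zero_le p) i
    have a2 : (Φ p z.2 i : ℝ) ≤ Φ 1 z.2 i := hΦ z.2 (cube_le_one p) i
    have a3 : (Φ 0 z.2 i : ℝ) ≤ Φ z.1 z.2 i := hΦ z.2 (cube_zero_le z.1) i
    have a4 : (Φ z.1 z.2 i : ℝ) ≤ Φ 1 z.2 i := hΦ z.2 (cube_le_one z.1) i
    constructor <;> linarith
  refine (lintegral_mono hpt).trans (le_of_eq ?_)
  have hS : Measurable fun ω => ∑ i, ENNReal.ofReal ((Φ 1 ω i : ℝ) - Φ 0 ω i) :=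
    Finset.measurable_fun_sum _ fun i _ => ((hcoord 1 i).sub (hcoord 0 i)).ennreal_ofReal
  rw [lintegral_prod (fun z : Cube d × Ω => ∑ i, ENNReal.ofReal ((Φ 1 z.2 i : ℝ) - Φ 0 z.2 i))
    (hS.comp measurable_snd).aemeasurable]
  simp only [lintegral_const, measure_univ, mul_one]
  rw [lintegral_finsetSum (f := fun i ω => ENNReal.ofReal ((Φ 1 ω i : ℝ) - Φ 0 ω i)) _
    fun i _ => ((hcoord 1 i).sub (hcoord 0 i)).ennreal_ofReal]
  refine Finset.sum_congr rfl fun i _ => ?_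
  have hint : ∀ q, Integrable (fun ω => ((Φ q ω i : unitInterval) : ℝ)) P := fun q =>
    Integrable.of_bound (hcoord q i).aestronglyMeasurable 1 (Filter.Eventually.of_forall fun ω => by
      rw [Real.norm_eq_abs, abs_of_nonneg (Φ q ω i).2.1]; exact (Φ q ω i).2.2)
  rw [← ofReal_integral_eq_lintegral_ofReal (f := fun ω => (Φ 1 ω i : ℝ) - Φ 0 ω i)
    ((hint 1).sub (hint 0)) (Filter.Eventually.of_forall fun ω => sub_nonneg.2 (hΦ ω (cube_zero_le 1) i)),
    integral_sub (hint 1) (hint 0)]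
  simp only [gibbsMean]
  have hcm : Measurable fun q : Cube d => ((q i : unitInterval) : ℝ) :=
    measurable_subtype_coe.comp (measurable_pi_apply i)
  rw [← hlaw, ← hlaw, integral_map (hΦq _).aemeasurable hcm.aestronglyMeasurable,
    integral_map (hΦq _).aemeasurable hcm.aestronglyMeasurable]

/-- A coordinate is 1-Lipschitz for the sup norm: the easy half of Kantorovich duality. -/
theorem ofReal_integral_sub_le_dInfty (i : Fin d) (μ ν : Measure (Cube d))
    [IsProbabilityMeasure μ] [IsProbabilityMeasure ν] :
    ENNReal.ofReal (∫ q, (q i : ℝ) ∂ν - ∫ q, (q i : ℝ) ∂μ) ≤ dInfty μ ν := by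
  refine le_iInf₂ fun γ hγ => ?_
  have hcm : Measurable fun q : Cube d => ((q i : unitInterval) : ℝ) :=
    measurable_subtype_coe.comp (measurable_pi_apply i)
  have hγp : IsProbabilityMeasure γ := ⟨by
    rw [← Set.preimage_univ (f := Prod.fst), ← Measure.map_apply measurable_fst MeasurableSet.univ,
      hγ.1, measure_univ]⟩
  rw [← hγ.1, ← hγ.2, integral_map measurable_fst.aemeasurable hcm.aestronglyMeasurable,
    integral_map measurable_snd.aemeasurable hcm.aestronglyMeasurable]
  have hb : ∀ q : Cube d, ‖((q i : unitInterval) : ℝ)‖ ≤ 1 := fun q => by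
    rw [Real.norm_eq_abs, abs_of_nonneg (q i).2.1]; exact (q i).2.2
  have h1 : Integrable (fun z : Cube d × Cube d => ((z.1 i : unitInterval) : ℝ)) γ :=
    Integrable.of_bound (hcm.comp measurable_fst).aestronglyMeasurable 1
      (Filter.Eventually.of_forall fun z => hb z.1)
  have h2 : Integrable (fun z : Cube d × Cube d => ((z.2 i : unitInterval) : ℝ)) γ :=
    Integrable.of_bound (hcm.comp measurable_snd).aestronglyMeasurable 1
      (Filter.Eventually.of_forall fun z => hb z.2)
  rw [← integral_sub h2 h1]
  refine (ENNReal.ofReal_le_ofReal ((Real.le_norm_self _).trans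
    (norm_integral_le_integral_norm _))).trans ?_
  rw [ofReal_integral_norm_eq_lintegral_enorm
    (f := fun z : Cube d × Cube d => (z.2 i : ℝ) - z.1 i) (h2.sub h1)]
  refine lintegral_mono fun z => ?_
  refine le_trans ?_ (edist_le_pi_edist z.1 z.2 i)
  rw [edist_dist, Subtype.dist_eq, Real.dist_eq, abs_sub_comm, ← Real.norm_eq_abs,
    ofReal_norm]

/-! ### The sampler acting on bounded measurable functions -/

/-- Bounded measurable functions on the cube. -/
structure BddMeas (h : Cube d → ℝ) : Prop where
  measurable : Measurable h
  bound : ∃ B, ∀ p, |h p| ≤ B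

theorem BddMeas.integrable {h : Cube d → ℝ} (hh : BddMeas h) (μ : Measure (Cube d))
    [IsFiniteMeasure μ] : Integrable h μ :=
  let ⟨B, hB⟩ := hh.bound
  Integrable.of_bound hh.measurable.aestronglyMeasurable B (Filter.Eventually.of_forall hB)

theorem BddMeas.of_continuous {h : Cube d → ℝ} (hh : Continuous h) : BddMeas h := by
  refine ⟨hh.measurable, ?_⟩
  obtain ⟨B, hB⟩ := isCompact_univ.exists_bound_of_continuousOn hh.continuousOn
  exact ⟨B, fun p => hB p (Set.mem_univ p)⟩

theorem BddMeas.add {f g : Cube d → ℝ} (hf : BddMeas f) (hg : BddMeas g) :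
    BddMeas fun p => f p + g p :=
  let ⟨B, hB⟩ := hf.bound
  let ⟨B', hB'⟩ := hg.bound
  ⟨hf.measurable.add hg.measurable, B + B', fun p =>
    (abs_add_le _ _).trans (add_le_add (hB p) (hB' p))⟩

theorem BddMeas.mul {f g : Cube d → ℝ} (hf : BddMeas f) (hg : BddMeas g) :
    BddMeas fun p => f p * g p :=
  let ⟨B, hB⟩ := hf.bound
  let ⟨B', hB'⟩ := hg.bound
  ⟨hf.measurable.mul hg.measurable, B * B', fun p => by
    rw [abs_mul]
    exact mul_le_mul (hB p) (hB' p) (abs_nonneg _) ((abs_nonneg _).trans (hB p))⟩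

theorem BddMeas.const (c : ℝ) : BddMeas fun _ : Cube d => c :=
  ⟨measurable_const, |c|, fun _ => le_rfl⟩

theorem BddMeas.sub {f g : Cube d → ℝ} (hf : BddMeas f) (hg : BddMeas g) :
    BddMeas fun p => f p - g p := by
  simpa [sub_eq_add_neg] using hf.add ((BddMeas.const (-1)).mul hg)

theorem BddMeas.sum {ι : Type*} (s : Finset ι) {f : ι → Cube d → ℝ} (hf : ∀ i, BddMeas (f i)) :
    BddMeas fun p => ∑ i ∈ s, f i p := by
  classical
  induction s using Finset.induction_on with
  | empty => simpa using BddMeas.const 0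
  | insert i s hi ih => simpa [Finset.sum_insert hi] using (hf i).add ih

/-- The conditional expectation of `h` given all the coordinates but the `i`-th. -/
def resample (C : Network d) (A : ℝ) (i : Fin d) (h : Cube d → ℝ) (p : Cube d) : ℝ :=
  ∫ u : unitInterval, h (stepMap C A i p u)

theorem abs_integral_le_of_bound {X : Type*} [MeasurableSpace X] (μ : Measure X)
    [IsProbabilityMeasure μ] {f : X → ℝ} {B : ℝ} (hB : ∀ x, |f x| ≤ B) : |∫ x, f x ∂μ| ≤ B := by
  simpa using norm_integral_le_of_norm_le_const (μ := μ) (f := f)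
    (Filter.Eventually.of_forall hB)

theorem BddMeas.resample {h : Cube d → ℝ} (hh : BddMeas h) (C : Network d) (A : ℝ) (i : Fin d) :
    BddMeas (resample C A i h) := by
  obtain ⟨B, hB⟩ := hh.bound
  refine ⟨?_, B, fun p => abs_integral_le_of_bound _ fun u => hB _⟩
  exact (StronglyMeasurable.integral_prod_right (ν := volume)
    (f := fun (p : Cube d) (u : unitInterval) => h (stepMap C A i p u))
    (hh.measurable.comp (measurable_stepMap C A i)).stronglyMeasurable).measurable

theorem BddMeas.integrable_stepMap {h : Cube d → ℝ} (hh : BddMeas h) (C : Network d) (A : ℝ)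
    (i : Fin d) (p : Cube d) :
    Integrable (fun u : unitInterval => h (stepMap C A i p u)) :=
  let ⟨B, hB⟩ := hh.bound
  Integrable.of_bound (hh.measurable.comp (measurable_stepMap_right C A i p)).aestronglyMeasurable B
    (Filter.Eventually.of_forall fun _ => hB _)

theorem resample_eq_integral_truncGauss {h : Cube d → ℝ} (hh : BddMeas h) (C : Network d) (A : ℝ)
    (i : Fin d) (p : Cube d) :
    resample C A i h p = ∫ x, h (Function.update p i x)
      ∂truncGauss (A ^ 2 * deg C i) (A ^ 2 * field C i (toVec p)) := by
  rw [← map_gaussQuantile, integral_map]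
  · rfl
  · exact ((measurable_gaussQuantile _).comp
      (measurable_const.prodMk measurable_id)).aemeasurable
  · exact (hh.measurable.comp (measurable_update p)).aestronglyMeasurable

theorem resample_update (C : Network d) (A : ℝ) (i : Fin d) (h : Cube d → ℝ) (p : Cube d)
    (x : unitInterval) : resample C A i h (Function.update p i x) = resample C A i h p := by
  simp only [resample, stepMap_update]

theorem resample_stepMap (C : Network d) (A : ℝ) (i : Fin d) (h : Cube d → ℝ) (p : Cube d)
    (u : unitInterval) : resample C A i h (stepMap C A i p u) = resample C A i h p :=
  resample_update C A i h p _

theorem integral_resample {h : Cube d → ℝ} (hh : BddMeas h) (C : Network d) (A : ℝ) (i : Fin d) :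
    ∫ p, resample C A i h p ∂stationary C A = ∫ p, h p ∂stationary C A := by
  have hm := measurable_stepMap C A i
  obtain ⟨B, hB⟩ := hh.bound
  conv_rhs => rw [← (measurePreserving_stepMap C A i).map_eq,
    integral_map hm.aemeasurable hh.measurable.aestronglyMeasurable]
  rw [integral_prod]
  · rfl
  · exact Integrable.of_bound (hh.measurable.comp hm).aestronglyMeasurable B
      (Filter.Eventually.of_forall fun _ => hB _)

theorem resample_mono {f g : Cube d → ℝ} (hf : BddMeas f) (hg : BddMeas g) (hfg : ∀ p, f p ≤ g p)
    (C : Network d) (A : ℝ) (i : Fin d) (p : Cube d) :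
    resample C A i f p ≤ resample C A i g p :=
  integral_mono (hf.integrable_stepMap C A i p) (hg.integrable_stepMap C A i p) fun _ => hfg _

theorem resample_sub {f g : Cube d → ℝ} (hf : BddMeas f) (hg : BddMeas g)
    (C : Network d) (A : ℝ) (i : Fin d) (p : Cube d) :
    resample C A i (fun q => f q - g q) p = resample C A i f p - resample C A i g p :=
  integral_sub (hf.integrable_stepMap C A i p) (hg.integrable_stepMap C A i p)

theorem resample_add_const {f : Cube d → ℝ} (hf : BddMeas f) (c : ℝ)
    (C : Network d) (A : ℝ) (i : Fin d) (p : Cube d) :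
    resample C A i (fun q => f q + c) p = resample C A i f p + c := by
  simp only [resample]
  rw [integral_add (hf.integrable_stepMap C A i p) (integrable_const _)]
  simp

theorem monotone_resample {h : Cube d → ℝ} (hh : BddMeas h) (hm : Monotone h) (C : Network d)
    (A : ℝ) (i : Fin d) : Monotone (resample C A i h) := fun p q hpq =>
  integral_mono (hh.integrable_stepMap C A i p) (hh.integrable_stepMap C A i q) fun u =>
    hm (stepMap_mono C A i u hpq)

/-- The Pythagorean identity for conditional expectations. -/
theorem integral_sub_resample_sq {h : Cube d → ℝ} (hh : BddMeas h) (C : Network d) (A : ℝ)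
    (i : Fin d) :
    ∫ p, (h p - resample C A i h p) ^ 2 ∂stationary C A =
      ∫ p, h p ^ 2 ∂stationary C A - ∫ p, resample C A i h p ^ 2 ∂stationary C A := by
  have hR := hh.resample C A i
  -- Averaging the product over coordinate `i` preserves its integral, and the factor `resample C A
  -- i h` comes out because it does not depend on that coordinate.
  have h1 : ∫ p, h p * resample C A i h p ∂stationary C A =
      ∫ p, resample C A i h p ^ 2 ∂stationary C A := by
    rw [← integral_resample (hh.mul hR) C A i]
    refine integral_congr_ae (Filter.Eventually.of_forall fun p => ?_)
    change ∫ u, h (stepMap C A i p u) * resample C A i h (stepMap C A i p u) = _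
    simp only [resample_stepMap]
    rw [integral_mul_const, sq]
    rfl
  have i1 := (hh.mul hh).integrable (stationary C A)
  have i2 := (hh.mul hR).integrable (stationary C A)
  have i3 := (hR.mul hR).integrable (stationary C A)
  have e : ∀ p, (h p - resample C A i h p) ^ 2 = h p * h p - 2 * (h p * resample C A i h p) +
      resample C A i h p * resample C A i h p := fun p => by ring
  simp only [e]
  rw [integral_add (f := fun p => h p * h p - 2 * (h p * resample C A i h p))
    (i1.sub (i2.const_mul 2)) i3, integral_sub i1 (i2.const_mul 2), integral_const_mul, h1]
  simp only [sq]
  ring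

/-- The transition operator. -/
def gibbsOp (C : Network d) (A : ℝ) (h : Cube d → ℝ) (p : Cube d) : ℝ :=
  (∑ i, resample C A i h p) / d

theorem BddMeas.gibbsOp {h : Cube d → ℝ} (hh : BddMeas h) (C : Network d) (A : ℝ) :
    BddMeas (gibbsOp C A h) := by
  have e : GibbsSampler.gibbsOp C A h = fun p => (d : ℝ)⁻¹ * ∑ i, GibbsSampler.resample C A i h p :=
    funext fun p => div_eq_inv_mul _ _
  rw [e]
  exact (BddMeas.const (d : ℝ)⁻¹).mul (BddMeas.sum Finset.univ fun i => hh.resample C A i)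

theorem integral_gibbsKernel {h : Cube d → ℝ} (hh : BddMeas h) (C : Network d) (A : ℝ)
    (p : Cube d) : ∫ q, h q ∂gibbsKernel C A p = gibbsOp C A h p := by
  have hmap : ∀ i, ∫ q, h q ∂(volume : Measure unitInterval).map (stepMap C A i p) =
      resample C A i h p := fun i =>
    integral_map (measurable_stepMap_right C A i p).aemeasurable hh.measurable.aestronglyMeasurable
  by_cases hd : d = 0
  · subst hd
    simp [gibbsKernel_apply, GibbsSampler.gibbsOp]
  rw [gibbsKernel_apply, integral_finsetSum_measure]
  · simp only [integral_smul_measure, hmap, ENNReal.toReal_inv, ENNReal.toReal_natCast, smul_eq_mul,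
      ← Finset.mul_sum]
    rw [GibbsSampler.gibbsOp, div_eq_inv_mul]
  · intro i _
    have := Measure.isProbabilityMeasure_map (μ := (volume : Measure unitInterval))
      (measurable_stepMap_right C A i p).aemeasurable
    exact (hh.integrable _).smul_measure (by simpa using hd)

theorem gibbsMean_zero (C : Network d) (A : ℝ) {h : Cube d → ℝ} (hh : BddMeas h) :
    gibbsMean C A 0 h = h := by
  ext p
  rw [gibbsMean, gibbsKernel_pow_zero_apply, integral_dirac' _ _ hh.measurable.stronglyMeasurable]

theorem BddMeas.gibbsMean [NeZero d] {h : Cube d → ℝ} (hh : BddMeas h) (C : Network d) (A : ℝ)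
    (k : ℕ) : BddMeas (gibbsMean C A k h) := by
  obtain ⟨B, hB⟩ := hh.bound
  exact ⟨hh.measurable.stronglyMeasurable.integral_kernel.measurable, B,
    fun p => abs_integral_le_of_bound _ hB⟩

theorem gibbsMean_succ [NeZero d] (C : Network d) (A : ℝ) (k : ℕ) {h : Cube d → ℝ}
    (hh : BddMeas h) : gibbsMean C A (k + 1) h = gibbsOp C A (gibbsMean C A k h) := by
  ext p
  rw [← integral_gibbsKernel (hh.gibbsMean C A k)]
  simp only [gibbsMean]
  rw [pow_succ]
  exact Kernel.integral_comp (κ := gibbsKernel C A) (η := gibbsKernel C A ^ k)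
    (hh.integrable (((gibbsKernel C A ^ k) ∘ₖ gibbsKernel C A) p))

theorem gibbsOp_mono {f g : Cube d → ℝ} (hf : BddMeas f) (hg : BddMeas g) (hfg : ∀ p, f p ≤ g p)
    (C : Network d) (A : ℝ) (p : Cube d) : gibbsOp C A f p ≤ gibbsOp C A g p :=
  div_le_div_of_nonneg_right (Finset.sum_le_sum fun i _ => resample_mono hf hg hfg C A i p)
    (Nat.cast_nonneg d)

theorem gibbsOp_add_const [NeZero d] {f : Cube d → ℝ} (hf : BddMeas f) (c : ℝ) (C : Network d)
    (A : ℝ) (p : Cube d) : gibbsOp C A (fun q => f q + c) p = gibbsOp C A f p + c := by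
  have hd : (d : ℝ) ≠ 0 := by simpa using NeZero.ne d
  simp only [gibbsOp, resample_add_const hf, Finset.sum_add_distrib, Finset.sum_const,
    Finset.card_univ, Fintype.card_fin, nsmul_eq_mul]
  field_simp

theorem gibbsOp_sub {f g : Cube d → ℝ} (hf : BddMeas f) (hg : BddMeas g) (C : Network d)
    (A : ℝ) (p : Cube d) :
    gibbsOp C A (fun q => f q - g q) p = gibbsOp C A f p - gibbsOp C A g p := by
  simp only [gibbsOp, resample_sub hf hg, Finset.sum_sub_distrib, sub_div]

theorem monotone_gibbsOp {h : Cube d → ℝ} (hh : BddMeas h) (hm : Monotone h) (C : Network d)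
    (A : ℝ) : Monotone (gibbsOp C A h) := fun _ _ hpq =>
  div_le_div_of_nonneg_right (Finset.sum_le_sum fun i _ => monotone_resample hh hm C A i hpq)
    (Nat.cast_nonneg d)

/-- The decay of the second moment under the transition operator. -/
theorem integral_gibbsOp_sq_le [NeZero d] {h : Cube d → ℝ} (hh : BddMeas h) (C : Network d)
    (A : ℝ) :
    ∫ p, gibbsOp C A h p ^ 2 ∂stationary C A +
      (∑ i, ∫ p, (h p - resample C A i h p) ^ 2 ∂stationary C A) / d ≤
      ∫ p, h p ^ 2 ∂stationary C A := by
  have hd : (0 : ℝ) < d := by exact_mod_cast Nat.pos_of_ne_zero (NeZero.ne d)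
  have hsq : ∀ {f : Cube d → ℝ}, BddMeas f → BddMeas fun p => f p ^ 2 := fun hf => by
    simpa [sq] using hf.mul hf
  -- Convexity of the square, for the average over vertices.
  have hpt : ∀ p, gibbsOp C A h p ^ 2 ≤ (∑ i, resample C A i h p ^ 2) / d := fun p => by
    have := sq_sum_le_card_mul_sum_sq (s := Finset.univ) (f := fun i => resample C A i h p)
    rw [Finset.card_univ, Fintype.card_fin] at this
    rw [gibbsOp, div_pow, div_le_div_iff₀ (by positivity) hd]
    nlinarith
  have hint := integral_mono ((hsq (hh.gibbsOp C A)).integrable (stationary C A))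
    (((BddMeas.sum Finset.univ fun i => hsq (hh.resample C A i)).integrable
      (stationary C A)).div_const (d : ℝ)) hpt
  rw [integral_div, integral_finsetSum _ fun i _ =>
    (hsq (hh.resample C A i)).integrable (stationary C A)] at hint
  simp only [integral_sub_resample_sq hh, Finset.sum_sub_distrib, Finset.sum_const,
    Finset.card_univ, Fintype.card_fin, nsmul_eq_mul, sub_div]
  rw [mul_div_cancel_left₀ _ hd.ne']
  linarith

/-- The second moment is at most 1 at the start and drops at each step by at least the Dirichlet sum
divided by `d`. These sums over `T` steps therefore total at most `d`, and one of them is at most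
the average. -/
theorem exists_dirichlet_le [NeZero d] {h : Cube d → ℝ} (hh : BddMeas h) (hb : ∀ p, |h p| ≤ 1)
    (C : Network d) (A : ℝ) {T : ℕ} (hT : 0 < T) :
    ∃ k < T, ∑ i, ∫ p, (gibbsMean C A k h p - resample C A i (gibbsMean C A k h) p) ^ 2
      ∂stationary C A ≤ d / T := by
  have hd : (0 : ℝ) < d := by exact_mod_cast Nat.pos_of_ne_zero (NeZero.ne d)
  set D : ℕ → ℝ := fun k => ∑ i, ∫ p, (gibbsMean C A k h p -
    resample C A i (gibbsMean C A k h) p) ^ 2 ∂stationary C A with hD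
  have htel : ∀ n, ∫ p, gibbsMean C A n h p ^ 2 ∂stationary C A +
      (∑ k ∈ Finset.range n, D k) / d ≤ 1 := by
    intro n
    induction n with
    | zero =>
      rw [gibbsMean_zero C A hh]
      simp only [Finset.range_zero, Finset.sum_empty, zero_div, add_zero]
      refine (le_abs_self _).trans (abs_integral_le_of_bound _ fun p => ?_)
      rw [abs_pow]
      exact pow_le_one₀ (abs_nonneg _) (hb p)
    | succ n ih =>
      have := integral_gibbsOp_sq_le (hh.gibbsMean C A n) C A
      rw [gibbsMean_succ C A n hh, Finset.sum_range_succ, add_div]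
      change _ + D n / d ≤ _ at this
      linarith
  by_contra hcon
  push Not at hcon
  have hsum : (T : ℝ) * (d / T) < ∑ k ∈ Finset.range T, D k := by
    have := Finset.sum_lt_sum_of_nonempty (s := Finset.range T)
      (Finset.nonempty_range_iff.2 hT.ne') fun k hk => hcon k (Finset.mem_range.1 hk)
    simpa using this
  have hT' : (0 : ℝ) < T := by exact_mod_cast hT
  rw [mul_div_cancel₀ _ hT'.ne'] at hsum
  have h1 := htel T
  have h2 : 0 ≤ ∫ p, gibbsMean C A T h p ^ 2 ∂stationary C A :=
    integral_nonneg fun p => sq_nonneg _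
  have h3 : 1 < (∑ k ∈ Finset.range T, D k) / d := (one_lt_div hd).2 hsum
  linarith

/-! ### Separable functions -/

theorem bddMeas_separable (w : Fin d → ℝ) {f : ℝ → ℝ} (hf : Continuous f) :
    BddMeas fun q : Cube d => ∑ j, w j * f (q j) :=
  BddMeas.of_continuous (by fun_prop)

theorem bddMeas_coord (i : Fin d) : BddMeas fun q : Cube d => (q i : ℝ) :=
  BddMeas.of_continuous (by fun_prop)

theorem resample_separable (C : Network d) (A : ℝ) (i : Fin d) (w : Fin d → ℝ) {f : ℝ → ℝ}
    (hf : Continuous f) (p : Cube d) :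
    resample C A i (fun q => ∑ j, w j * f (q j)) p =
      ∑ j, w j * f (p j) - w i * f (p i) +
        w i * ∫ x, f x ∂truncGauss (A ^ 2 * deg C i) (A ^ 2 * field C i (toVec p)) := by
  rw [resample_eq_integral_truncGauss (bddMeas_separable w hf)]
  have h : ∀ x : unitInterval, ∑ j, w j * f (Function.update p i x j) =
      (∑ j, w j * f (p j) - w i * f (p i)) + w i * f x := fun x => by
    rw [← Finset.add_sum_erase _ _ (Finset.mem_univ i),
      ← Finset.add_sum_erase (a := i) _ (fun j => w j * f (p j)) (Finset.mem_univ i)]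
    rw [Finset.sum_congr rfl fun j hj => by rw [Function.update_of_ne (Finset.ne_of_mem_erase hj)]]
    simp only [Function.update_self]
    ring
  have hi : Integrable (fun x : unitInterval => f x)
      (truncGauss (A ^ 2 * deg C i) (A ^ 2 * field C i (toVec p))) :=
    integrable_of_continuous (by fun_prop)
  simp only [h]
  rw [integral_add (integrable_const _) (hi.const_mul _), integral_const_mul]
  simp

/-- By symmetry the degrees are an invariant measure for averaging over neighbours; this is why
degree-weighted sums are the right quantities to follow. -/
theorem sum_sum_weight_mul (C : Network d) (f : Fin d → ℝ) :
    ∑ i, ∑ j, C.weight i j * f j = ∑ j, deg C j * f j := by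
  rw [Finset.sum_comm]
  refine Finset.sum_congr rfl fun j _ => ?_
  rw [deg, Finset.sum_mul]
  exact Finset.sum_congr rfl fun i _ => by rw [C.symm]

/-! ### Slow growth from the corner `0` -/

/-- Expanding `∑ c_ij (x - p_j)² ≥ 0` bounds `deg x²` by the neighbours' squares plus twice `x (deg
x - field)`, whose conditional mean is at most `1 / (2 A²)` by `gauss_second_moment_le`. -/
theorem deg_mul_second_moment_le (C : Network d) {A : ℝ} (hA : A ≠ 0) (i : Fin d) (p : Cube d) :
    deg C i * ∫ x, (x : ℝ) ^ 2 ∂truncGauss (A ^ 2 * deg C i) (A ^ 2 * field C i (toVec p)) ≤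
      ∑ j, C.weight i j * (p j : ℝ) ^ 2 + 1 / A ^ 2 := by
  have hA2 : 0 < A ^ 2 := by positivity
  set μ := truncGauss (A ^ 2 * deg C i) (A ^ 2 * field C i (toVec p))
  have hpt : ∀ x : unitInterval, deg C i * (x : ℝ) ^ 2 ≤ ∑ j, C.weight i j * (p j : ℝ) ^ 2 +
      2 / A ^ 2 * ((x : ℝ) * (A ^ 2 * deg C i * x - A ^ 2 * field C i (toVec p))) := fun x => by
    have h1 : 2 * (x : ℝ) * field C i (toVec p) ≤
        deg C i * (x : ℝ) ^ 2 + ∑ j, C.weight i j * (p j : ℝ) ^ 2 := by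
      rw [field, deg, Finset.mul_sum, Finset.sum_mul, ← Finset.sum_add_distrib]
      refine Finset.sum_le_sum fun j _ => ?_
      have := mul_nonneg (C.nonneg i j) (sq_nonneg ((x : ℝ) - p j))
      simp only [toVec]
      nlinarith
    have h2 : 2 / A ^ 2 * ((x : ℝ) * (A ^ 2 * deg C i * x - A ^ 2 * field C i (toVec p))) =
        2 * (deg C i * (x : ℝ) ^ 2) - 2 * (x : ℝ) * field C i (toVec p) := by
      field_simp
    linarith
  have i1 : Integrable (fun x : unitInterval => deg C i * (x : ℝ) ^ 2) μ :=
    integrable_of_continuous (by fun_prop)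
  have i2 : Integrable (fun x : unitInterval => 2 / A ^ 2 *
      ((x : ℝ) * (A ^ 2 * deg C i * x - A ^ 2 * field C i (toVec p)))) μ :=
    integrable_of_continuous (by fun_prop)
  have h := integral_mono i1 ((integrable_const _).add i2) hpt
  have hm := gauss_second_moment_le (A ^ 2 * deg C i) (A ^ 2 * field C i (toVec p))
  rw [integral_add' (integrable_const _) i2, integral_const_mul, integral_const_mul] at h
  have h3 : 2 / A ^ 2 * ∫ x, (x : ℝ) * (A ^ 2 * deg C i * x - A ^ 2 * field C i (toVec p)) ∂μ ≤
      2 / A ^ 2 * (1 / 2) := mul_le_mul_of_nonneg_left hm (by positivity)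
  have h4 : 2 / A ^ 2 * (1 / 2) = 1 / A ^ 2 := by ring
  simp only [integral_const, probReal_univ, smul_eq_mul, one_mul] at h
  linarith

/-- Averaged over the chosen vertex, the removed terms `deg_i p_i²` and the neighbour sums cancel
exactly, which leaves a drift of at most `1 / A²` per step. -/
theorem gibbsMean_sum_sq_le [NeZero d] (C : Network d) {A : ℝ} (hA : A ≠ 0) (k : ℕ)
    (p : Cube d) :
    gibbsMean C A k (fun q => ∑ j, deg C j * (q j : ℝ) ^ 2) p ≤
      ∑ j, deg C j * (p j : ℝ) ^ 2 + k / A ^ 2 := by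
  have hd : (0 : ℝ) < d := by exact_mod_cast Nat.pos_of_ne_zero (NeZero.ne d)
  set F : Cube d → ℝ := fun q => ∑ j, deg C j * (q j : ℝ) ^ 2 with hF
  have hFb : BddMeas F := bddMeas_separable (deg C) (continuous_pow 2)
  have hstep : ∀ p, gibbsOp C A F p ≤ F p + 1 / A ^ 2 := fun p => by
    rw [gibbsOp, div_le_iff₀ hd]
    calc ∑ i, resample C A i F p
        ≤ ∑ i, (F p - deg C i * (p i : ℝ) ^ 2 +
            (∑ j, C.weight i j * (p j : ℝ) ^ 2 + 1 / A ^ 2)) := by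
          refine Finset.sum_le_sum fun i _ => ?_
          rw [hF, resample_separable C A i (deg C) (continuous_pow 2)]
          have := deg_mul_second_moment_le C hA i p
          simp only
          linarith
      _ = (F p + 1 / A ^ 2) * d := by
          rw [Finset.sum_add_distrib, Finset.sum_add_distrib, Finset.sum_sub_distrib,
            sum_sum_weight_mul]
          simp only [Finset.sum_const, Finset.card_univ, Fintype.card_fin, nsmul_eq_mul, hF]
          ring
  induction k generalizing p with
  | zero => rw [gibbsMean_zero C A hFb]; simp [hF]
  | succ k ih =>
    rw [gibbsMean_succ C A k hFb]
    refine (gibbsOp_mono (hFb.gibbsMean C A k) (hFb.add (BddMeas.const _)) ih C A p).trans ?_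
    rw [gibbsOp_add_const hFb]
    have := hstep p
    push_cast
    rw [add_div]
    linarith

theorem gibbsMean_coord_zero_le [NeZero d] (C : Network d) {A : ℝ} (hA : A ≠ 0) {i : Fin d}
    (hi : 0 < deg C i) {k : ℕ} (hk : (k : ℝ) ≤ deg C i / 16 * A ^ 2) :
    gibbsMean C A k (fun q => (q i : ℝ)) 0 ≤ 1 / 4 := by
  have h := gibbsMean_sum_sq_le C hA k 0
  have hA2 : 0 < A ^ 2 := by positivity
  -- This is `t ≤ 2 t² + 1/8`, a rewriting of `(t - 1/4)² ≥ 0`. The factor 1/16 in the time bound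
  -- makes the quadratic part contribute another 1/8.
  have hpt : ∀ q : Cube d, (q i : ℝ) ≤
      2 / deg C i * (∑ j, deg C j * (q j : ℝ) ^ 2) + 1 / 8 := fun q => by
    have h1 : deg C i * (q i : ℝ) ^ 2 ≤ ∑ j, deg C j * (q j : ℝ) ^ 2 :=
      Finset.single_le_sum (f := fun j => deg C j * (q j : ℝ) ^ 2)
        (fun j _ => mul_nonneg (deg_nonneg C j) (sq_nonneg _)) (Finset.mem_univ i)
    have h2 := mul_le_mul_of_nonneg_left h1 (by positivity : 0 ≤ 2 / deg C i)
    have h3 : 2 / deg C i * (deg C i * (q i : ℝ) ^ 2) = 2 * (q i : ℝ) ^ 2 := by field_simp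
    nlinarith [sq_nonneg ((q i : ℝ) - 1 / 4)]
  have hFb : BddMeas fun q : Cube d => ∑ j, deg C j * (q j : ℝ) ^ 2 :=
    bddMeas_separable (deg C) (continuous_pow 2)
  have hm : gibbsMean C A k (fun q => (q i : ℝ)) 0 ≤
      2 / deg C i * gibbsMean C A k (fun q => ∑ j, deg C j * (q j : ℝ) ^ 2) 0 + 1 / 8 := by
    have i1 := hFb.integrable ((gibbsKernel C A ^ k) 0)
    have := integral_mono ((bddMeas_coord i).integrable ((gibbsKernel C A ^ k) 0))
      ((i1.const_mul (2 / deg C i)).add (integrable_const (1 / 8))) hpt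
    rw [integral_add' (i1.const_mul _) (integrable_const _), integral_const_mul] at this
    simpa [gibbsMean] using this
  have h0 : ∑ j, deg C j * (((0 : Cube d) j : unitInterval) : ℝ) ^ 2 = 0 := by simp
  rw [h0, zero_add] at h
  have h5 : (k : ℝ) / A ^ 2 ≤ deg C i / 16 := by rw [div_le_iff₀ hA2]; exact hk
  have h6 := mul_le_mul_of_nonneg_left (h.trans h5) (by positivity : 0 ≤ 2 / deg C i)
  have h7 : 2 / deg C i * (deg C i / 16) = 1 / 8 := by field_simp; norm_num
  linarith

/-! ### Symmetry of the stationary measure and the lower bound on the distance -/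

/-- Reflection of the cube. -/
def reflect (p : Cube d) : Cube d := fun i => unitInterval.symm (p i)

theorem energy_reflect (C : Network d) (p : Cube d) : energy C (reflect p) = energy C p := by
  simp only [energy, reflect, unitInterval.coe_symm_eq]
  refine Finset.sum_congr rfl fun i _ => Finset.sum_congr rfl fun j _ => ?_
  ring

theorem integral_coord_stationary (C : Network d) (A : ℝ) (i : Fin d) :
    ∫ p, (p i : ℝ) ∂stationary C A = 1 / 2 := by
  have hmp : MeasurePreserving (reflect (d := d)) volume volume :=
    volume_preserving_pi fun _ => unitInterval.measurePreserving_symm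
  have hm : Measurable (reflect (d := d)) := hmp.measurable
  have hemb : MeasurableEmbedding (reflect (d := d)) :=
    MeasurableEquiv.measurableEmbedding
      { toFun := reflect
        invFun := reflect
        left_inv := fun p => by ext; simp [reflect]
        right_inv := fun p => by ext; simp [reflect]
        measurable_toFun := hm
        measurable_invFun := hm }
  have h : ∫ p, (p i : ℝ) ∂stationary C A = ∫ p, (1 - (p i : ℝ)) ∂stationary C A := by
    simp only [stationary, integral_tilted]
    rw [← hmp.integral_comp hemb]
    simp only [energy_reflect]
    refine integral_congr_ae (Filter.Eventually.of_forall fun p => ?_)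
    simp [reflect]
  rw [integral_sub (integrable_const _) ((bddMeas_coord i).integrable _)] at h
  simp only [integral_const, probReal_univ, smul_eq_mul, one_mul] at h
  linarith

theorem dInfty_zero_ge [NeZero d] (C : Network d) {A : ℝ} (hA : A ≠ 0) {i : Fin d}
    (hi : 0 < deg C i) {k : ℕ} (hk : (k : ℝ) ≤ deg C i / 16 * A ^ 2) :
    ENNReal.ofReal (1 / 4) ≤ dInfty ((gibbsKernel C A ^ k) 0) (stationary C A) := by
  refine le_trans (ENNReal.ofReal_le_ofReal ?_)
    (ofReal_integral_sub_le_dInfty i ((gibbsKernel C A ^ k) 0) (stationary C A))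
  rw [integral_coord_stationary]
  have := gibbsMean_coord_zero_le C hA hi hk
  rw [gibbsMean] at this
  linarith

/-! ### Lipschitz bounds that are preserved by the sampler -/

/-- No edge joins `S` to its complement. -/
def IsClosedSet (C : Network d) (S : Finset (Fin d)) : Prop :=
  ∀ i j, 0 < C.weight i j → (i ∈ S ↔ j ∈ S)

open Classical in
/-- The weight of a vertex of `S`: its degree, or `1` for an isolated vertex. -/
def vertexWeight (C : Network d) (S : Finset (Fin d)) (i : Fin d) : ℝ :=
  if i ∈ S then deg C i + (if deg C i = 0 then 1 else 0) else 0

theorem vertexWeight_nonneg (C : Network d) (S : Finset (Fin d)) (i : Fin d) :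
    0 ≤ vertexWeight C S i := by
  unfold vertexWeight
  have := deg_nonneg C i
  split_ifs <;> linarith

theorem vertexWeight_pos (C : Network d) {S : Finset (Fin d)} {i : Fin d} (hi : i ∈ S) :
    0 < vertexWeight C S i := by
  unfold vertexWeight
  rw [if_pos hi]
  have := deg_nonneg C i
  split_ifs with h
  · linarith
  · simpa using lt_of_le_of_ne this (Ne.symm h)

/-- The weighted sum of the coordinates in `S`. -/
def weightedSum (C : Network d) (S : Finset (Fin d)) (p : Cube d) : ℝ :=
  ∑ i, vertexWeight C S i * (p i : ℝ)

theorem weight_eq_zero_of_deg_eq_zero {C : Network d} {i : Fin d} (hi : deg C i = 0) (j : Fin d) :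
    C.weight i j = 0 :=
  (Finset.sum_eq_zero_iff_of_nonneg fun j _ => C.nonneg i j).1 hi j (Finset.mem_univ j)

theorem field_eq_zero_of_deg_eq_zero {C : Network d} {i : Fin d} (hi : deg C i = 0)
    (x : Fin d → ℝ) : field C i x = 0 :=
  Finset.sum_eq_zero fun j _ => by rw [weight_eq_zero_of_deg_eq_zero hi, zero_mul]

theorem deg_mul_mean_sub_le (C : Network d) {A : ℝ} (hA : A ≠ 0) (i : Fin d) {p q : Cube d}
    (hpq : p ≤ q) :
    deg C i * (∫ x, (x : ℝ) ∂truncGauss (A ^ 2 * deg C i) (A ^ 2 * field C i (toVec q))) -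
      deg C i * (∫ x, (x : ℝ) ∂truncGauss (A ^ 2 * deg C i) (A ^ 2 * field C i (toVec p))) ≤
      field C i (toVec q) - field C i (toVec p) := by
  have hA2 : 0 < A ^ 2 := by positivity
  have h := gauss_mean_sub_le (A ^ 2 * deg C i)
    (mul_le_mul_of_nonneg_left (field_mono C i (toVec_mono hpq)) hA2.le)
  refine le_of_mul_le_mul_left ?_ hA2
  linarith

/-- The balance of `sum_sum_weight_mul` survives restriction to `S`, because no weight crosses its
boundary. -/
theorem sum_field_eq (C : Network d) {S : Finset (Fin d)} (hS : IsClosedSet C S)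
    (x : Fin d → ℝ) : ∑ i ∈ S, field C i x = ∑ i ∈ S, deg C i * x i := by
  classical
  have h1 : ∑ i ∈ S, field C i x = ∑ i, ∑ j, C.weight i j * (if j ∈ S then x j else 0) := by
    rw [← Finset.sum_filter_add_sum_filter_not Finset.univ (· ∈ S)]
    rw [Finset.sum_eq_zero (s := Finset.univ.filter (· ∉ S)), add_zero, show Finset.univ.filter (· ∈ S) = S by ext; simp]
    · refine Finset.sum_congr rfl fun i hi => Finset.sum_congr rfl fun j _ => ?_
      split_ifs with hj
      · rfl
      · have : C.weight i j = 0 := by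
          by_contra h
          exact hj ((hS i j (lt_of_le_of_ne (C.nonneg i j) (Ne.symm h))).1 hi)
        simp [this]
    · intro i hi
      refine Finset.sum_eq_zero fun j _ => ?_
      split_ifs with hj
      · have : C.weight i j = 0 := by
          by_contra h
          exact (Finset.mem_filter.1 hi).2
            ((hS i j (lt_of_le_of_ne (C.nonneg i j) (Ne.symm h))).2 hj)
        simp [this]
      · simp
  rw [h1, sum_sum_weight_mul]
  simp [Finset.sum_ite_mem]

/-- Resampling replaces `p i` by its conditional mean, whose increments times the degree are at most
those of the field. Summed over the closed set `S`, the field increments equal the degree-weighted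
increments of the configuration, so the sampler does not enlarge increments of the weighted sum. -/
theorem monotone_weightedSum_sub_gibbsOp (C : Network d) {A : ℝ} (hA : A ≠ 0)
    {S : Finset (Fin d)} (hS : IsClosedSet C S) :
    Monotone fun p => weightedSum C S p - gibbsOp C A (weightedSum C S) p := by
  by_cases hd0 : d = 0
  · subst hd0; intro p q _; rw [Subsingleton.elim p q]
  have hd : (0 : ℝ) < d := by exact_mod_cast Nat.pos_of_ne_zero hd0
  let φ : Fin d → Cube d → ℝ := fun i p =>
    ∫ x, (x : ℝ) ∂truncGauss (A ^ 2 * deg C i) (A ^ 2 * field C i (toVec p))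
  have hop : ∀ p, weightedSum C S p - gibbsOp C A (weightedSum C S) p =
      (∑ i, vertexWeight C S i * ((p i : ℝ) - φ i p)) / d := fun p => by
    have hr : ∀ i, resample C A i (weightedSum C S) p =
        weightedSum C S p - vertexWeight C S i * ((p i : ℝ) - φ i p) := fun i => by
      have := resample_separable C A i (vertexWeight C S) continuous_id p
      simp only [id] at this
      change resample C A i (weightedSum C S) p = weightedSum C S p - _ + _ * φ i p at this
      rw [this]; ring
    rw [gibbsOp, eq_div_iff hd.ne', sub_mul, div_mul_cancel₀ _ hd.ne']
    simp only [hr, Finset.sum_sub_distrib, Finset.sum_const, Finset.card_univ, Fintype.card_fin,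
      nsmul_eq_mul]
    ring
  intro p q hpq
  simp only [hop]
  refine div_le_div_of_nonneg_right ?_ hd.le
  -- At an isolated vertex the conditional mean is constant, so the extra weight 1 is harmless.
  have hterm : ∀ i, vertexWeight C S i * (φ i q - φ i p) ≤
      if i ∈ S then field C i (toVec q) - field C i (toVec p) else 0 := fun i => by
    unfold vertexWeight
    split_ifs with hi h0
    · simp [φ, h0, field_eq_zero_of_deg_eq_zero h0]
    · have := deg_mul_mean_sub_le C hA i hpq
      simp only [φ]
      linarith
    · simp
  have hdeg : ∀ i, (if i ∈ S then deg C i * ((q i : ℝ) - p i) else 0) ≤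
      vertexWeight C S i * ((q i : ℝ) - p i) := fun i => by
    have hi0 : (0 : ℝ) ≤ (q i : ℝ) - p i := sub_nonneg.2 (hpq i)
    unfold vertexWeight
    split_ifs with hi h0 <;> nlinarith
  have hsum := Finset.sum_le_sum fun i (_ : i ∈ Finset.univ) => hterm i
  have hsum' := Finset.sum_le_sum fun i (_ : i ∈ Finset.univ) => hdeg i
  rw [Finset.sum_ite_mem, Finset.univ_inter] at hsum hsum'
  have hfield : ∑ i ∈ S, (field C i (toVec q) - field C i (toVec p)) =
      ∑ i ∈ S, deg C i * ((q i : ℝ) - p i) := by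
    rw [Finset.sum_sub_distrib, sum_field_eq C hS, sum_field_eq C hS, ← Finset.sum_sub_distrib]
    exact Finset.sum_congr rfl fun i _ => by simp only [toVec]; ring
  have e : ∑ i, vertexWeight C S i * ((q i : ℝ) - φ i q) -
      ∑ i, vertexWeight C S i * ((p i : ℝ) - φ i p) =
      ∑ i, vertexWeight C S i * ((q i : ℝ) - p i) -
        ∑ i, vertexWeight C S i * (φ i q - φ i p) := by
    simp only [← Finset.sum_sub_distrib]
    exact Finset.sum_congr rfl fun i _ => by ring
  linarith

/-- The means of a coordinate in `S` are monotone in the initial state, and dominated by the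
weighted sum over `S`. -/
theorem gibbsMean_coord_regular [NeZero d] (C : Network d) {A : ℝ} (hA : A ≠ 0)
    {S : Finset (Fin d)} (hS : IsClosedSet C S) {i : Fin d} (hi : i ∈ S) (k : ℕ) :
    Monotone (gibbsMean C A k fun q => (q i : ℝ)) ∧
      Monotone fun p => (vertexWeight C S i)⁻¹ * weightedSum C S p -
        gibbsMean C A k (fun q => (q i : ℝ)) p := by
  have hw := vertexWeight_pos C hi
  have hℓb : BddMeas (weightedSum C S) := bddMeas_separable (vertexWeight C S) continuous_id
  induction k with
  | zero =>
    rw [gibbsMean_zero C A (bddMeas_coord i)]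
    refine ⟨fun p q h => h i, fun p q h => ?_⟩
    have : vertexWeight C S i * ((q i : ℝ) - p i) ≤ weightedSum C S q - weightedSum C S p := by
      rw [weightedSum, weightedSum, ← Finset.sum_sub_distrib]
      simp only [← mul_sub]
      exact Finset.single_le_sum (f := fun j => vertexWeight C S j * ((q j : ℝ) - p j))
        (fun j _ => mul_nonneg (vertexWeight_nonneg C S j) (sub_nonneg.2 (h j)))
        (Finset.mem_univ i)
    have h2 := mul_le_mul_of_nonneg_left this (inv_pos.2 hw).le
    rw [inv_mul_cancel_left₀ hw.ne'] at h2
    simp only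
    linarith
  | succ k ih =>
    rw [gibbsMean_succ C A k (bddMeas_coord i)]
    have hb := (bddMeas_coord i).gibbsMean C A k
    refine ⟨monotone_gibbsOp hb ih.1 C A, fun p q hpq => ?_⟩
    have hcb := (BddMeas.const (d := d) (vertexWeight C S i)⁻¹).mul hℓb
    -- With `K` the transition operator and `ℓ` the weighted sum, `c ℓ - h_{k+1} = c (ℓ - K ℓ) + K
    -- (c ℓ - h_k)`, a sum of two monotone functions.
    have h1 := monotone_gibbsOp (hcb.sub hb) ih.2 C A hpq
    rw [gibbsOp_sub hcb hb, gibbsOp_sub hcb hb] at h1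
    have hc : ∀ p, gibbsOp C A (fun q => (vertexWeight C S i)⁻¹ * weightedSum C S q) p =
        (vertexWeight C S i)⁻¹ * gibbsOp C A (weightedSum C S) p := fun p => by
      simp only [gibbsOp, resample, integral_const_mul, ← Finset.mul_sum, mul_div_assoc]
    rw [hc, hc] at h1
    have h2 := mul_le_mul_of_nonneg_left (monotone_weightedSum_sub_gibbsOp C hA hS hpq)
      (inv_pos.2 hw).le
    simp only [mul_sub] at h2
    simp only
    linarith

/-! ### The stationary measure seen from `ℝ^d` -/

/-- Coordinatewise projection to the cube. -/
def clamp (x : Fin d → ℝ) : Cube d := fun i => Set.projIcc 0 1 zero_le_one (x i)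

theorem continuous_clamp : Continuous (clamp (d := d)) :=
  continuous_pi fun i => continuous_projIcc.comp (continuous_apply i)

theorem measurable_clamp : Measurable (clamp (d := d)) := continuous_clamp.measurable

theorem clamp_toVec (p : Cube d) : clamp (toVec p) = p :=
  funext fun i => Set.projIcc_val zero_le_one (p i)

theorem coe_clamp {x : Fin d → ℝ} (hx : x ∈ Set.Icc (0 : Fin d → ℝ) 1) (i : Fin d) :
    (clamp x i : ℝ) = x i := by
  rw [clamp, Set.projIcc_of_mem zero_le_one ⟨hx.1 i, hx.2 i⟩]

theorem clamp_update (x : Fin d → ℝ) (i : Fin d) (t : ℝ) :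
    clamp (Function.update x i t) =
      Function.update (clamp x) i (Set.projIcc 0 1 zero_le_one t) := by
  ext k
  by_cases h : k = i
  · subst h; simp [clamp]
  · simp [clamp, h]

/-- Passing to `ℝ^d` makes the translation invariance of Lebesgue measure available. -/
theorem lintegral_cube_eq {H : (Fin d → ℝ) → ℝ≥0∞} (hH : Measurable H) :
    ∫⁻ p : Cube d, H (toVec p) = ∫⁻ x in Set.Icc (0 : Fin d → ℝ) 1, H x := by
  have h1 : MeasurePreserving (fun x : unitInterval => (x : ℝ)) volume
      (volume.restrict (Set.Icc (0 : ℝ) 1)) :=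
    ⟨measurable_subtype_coe, map_comap_subtype_coe measurableSet_Icc volume⟩
  have h2 := measurePreserving_pi (fun _ : Fin d => (volume : Measure unitInterval))
    (fun _ => volume.restrict (Set.Icc (0 : ℝ) 1)) fun _ => h1
  have h3 : Measure.pi (fun _ : Fin d => volume.restrict (Set.Icc (0 : ℝ) 1)) =
      (volume : Measure (Fin d → ℝ)).restrict (Set.Icc 0 1) := by
    rw [← Set.pi_univ_Icc]
    exact (Measure.restrict_pi_pi (fun _ : Fin d => (volume : Measure ℝ))
      (fun _ => Set.Icc 0 1)).symm
  rw [h3] at h2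
  exact h2.lintegral_comp hH

/-- The unnormalized density of the stationary measure. -/
def density (C : Network d) (A : ℝ) (x : Fin d → ℝ) : ℝ≥0∞ :=
  ENNReal.ofReal (Real.exp (-(A ^ 2 * quadEnergy C x)))

/-- The normalizing constant. -/
def partition (C : Network d) (A : ℝ) : ℝ≥0∞ :=
  ∫⁻ x in Set.Icc (0 : Fin d → ℝ) 1, density C A x

theorem measurable_density (C : Network d) (A : ℝ) : Measurable (density C A) := by
  have := (continuous_quadEnergy C).measurable
  unfold density
  fun_prop

theorem density_le_one (C : Network d) (A : ℝ) (x : Fin d → ℝ) : density C A x ≤ 1 := by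
  rw [density, ENNReal.ofReal_le_one, Real.exp_le_one_iff, neg_nonpos]
  exact mul_nonneg (sq_nonneg A) (quadEnergy_nonneg C x)

theorem partition_eq (C : Network d) (A : ℝ) :
    partition C A = ENNReal.ofReal (∫ p : Cube d, Real.exp (-A ^ 2 * energy C p)) := by
  rw [partition, ← lintegral_cube_eq (measurable_density C A),
    ofReal_integral_eq_lintegral_ofReal (integrable_exp_energy C A)
      (Filter.Eventually.of_forall fun p => (Real.exp_pos _).le)]
  refine lintegral_congr fun p => ?_
  rw [density, energy_eq_quadEnergy, neg_mul]

theorem partition_ne_zero (C : Network d) (A : ℝ) : partition C A ≠ 0 := by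
  rw [partition_eq, ne_eq, ENNReal.ofReal_eq_zero, not_le]
  exact integral_exp_pos (integrable_exp_energy C A)

theorem partition_ne_top (C : Network d) (A : ℝ) : partition C A ≠ ∞ := by
  rw [partition_eq]; exact ENNReal.ofReal_ne_top

theorem partition_mul_lintegral (C : Network d) (A : ℝ) {F : Cube d → ℝ≥0∞} (hF : Measurable F) :
    partition C A * ∫⁻ p, F p ∂stationary C A =
      ∫⁻ x in Set.Icc (0 : Fin d → ℝ) 1, density C A x * F (clamp x) := by
  have hm : Measurable fun x : Fin d → ℝ => density C A x * F (clamp x) :=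
    (measurable_density C A).mul (hF.comp measurable_clamp)
  have hZ : 0 < ∫ p : Cube d, Real.exp (-A ^ 2 * energy C p) :=
    integral_exp_pos (integrable_exp_energy C A)
  have hE := measurable_energy C
  rw [← lintegral_cube_eq hm, stationary, lintegral_tilted, partition_eq,
    ← lintegral_const_mul _ (by fun_prop)]
  refine lintegral_congr fun p => ?_
  rw [← mul_assoc, ← ENNReal.ofReal_mul hZ.le, mul_div_cancel₀ _ hZ.ne', clamp_toVec, density,
    energy_eq_quadEnergy, neg_mul]

/-- On a set of low energy, the stationary measure controls the Lebesgue measure. -/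
theorem setLIntegral_translate_le (C : Network d) (A M : ℝ) {F : Cube d → ℝ≥0∞}
    (hF : Measurable F) {G : Set (Fin d → ℝ)} (hG : MeasurableSet G) (v : Fin d → ℝ)
    (hv : ∀ x ∈ G, x + v ∈ Set.Icc (0 : Fin d → ℝ) 1 ∧ A ^ 2 * quadEnergy C (x + v) ≤ M) :
    ∫⁻ x in G, F (clamp (x + v)) ≤
      ENNReal.ofReal (Real.exp M) * (partition C A * ∫⁻ p, F p ∂stationary C A) := by
  set L : Set (Fin d → ℝ) := {x | x ∈ Set.Icc (0 : Fin d → ℝ) 1 ∧ A ^ 2 * quadEnergy C x ≤ M}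
    with hLdef
  have hL : MeasurableSet L := measurableSet_Icc.inter
    (measurableSet_le ((continuous_quadEnergy C).measurable.const_mul _) measurable_const)
  calc ∫⁻ x in G, F (clamp (x + v))
      = ∫⁻ x, G.indicator (fun x => F (clamp (x + v))) x := (lintegral_indicator hG _).symm
    _ ≤ ∫⁻ x, L.indicator (fun x => F (clamp x)) (x + v) := by
        refine lintegral_mono fun x => ?_
        by_cases hx : x ∈ G
        · rw [Set.indicator_of_mem hx, Set.indicator_of_mem (show x + v ∈ L from hv x hx)]
        · rw [Set.indicator_of_notMem hx]; exact zero_le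
    _ = ∫⁻ x in L, F (clamp x) := by
        rw [lintegral_add_right_eq_self (fun x => L.indicator (fun x => F (clamp x)) x) v,
          lintegral_indicator hL]
    -- On `L` the density is at least `exp (-M)`.
    _ ≤ ∫⁻ x in L, ENNReal.ofReal (Real.exp M) * (density C A x * F (clamp x)) := by
        refine setLIntegral_mono' hL fun x hx => ?_
        rw [← mul_assoc, density, ← ENNReal.ofReal_mul (Real.exp_pos M).le, ← Real.exp_add]
        refine le_mul_of_one_le_left zero_le ?_
        rw [ENNReal.one_le_ofReal, Real.one_le_exp_iff]
        linarith [hx.2]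
    _ ≤ ∫⁻ x in Set.Icc (0 : Fin d → ℝ) 1,
          ENNReal.ofReal (Real.exp M) * (density C A x * F (clamp x)) :=
        lintegral_mono_set fun x hx => hx.1
    _ = ENNReal.ofReal (Real.exp M) * (partition C A * ∫⁻ p, F p ∂stationary C A) := by
        have hm : Measurable fun x : Fin d → ℝ => density C A x * F (clamp x) :=
          (measurable_density C A).mul (hF.comp measurable_clamp)
        rw [lintegral_const_mul _ hm, partition_mul_lintegral C A hF]

/-! ### Shifts along a set of vertices -/

/-- The indicator vector of a set of vertices. -/
def ind (T : Finset (Fin d)) : Fin d → ℝ := fun i => if i ∈ T then 1 else 0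

theorem quadEnergy_add_ind (C : Network d) {S : Finset (Fin d)} (hS : IsClosedSet C S)
    (x : Fin d → ℝ) (t : ℝ) : quadEnergy C (x + t • ind S) = quadEnergy C x := by
  unfold quadEnergy
  congr 1
  refine Finset.sum_congr rfl fun i _ => Finset.sum_congr rfl fun j _ => ?_
  rcases (C.nonneg i j).eq_or_lt with h | h
  · rw [← h]; simp
  · have := hS i j h
    have e : ind S i = ind S j := by simp only [ind, this]
    simp only [Pi.add_apply, Pi.smul_apply, smul_eq_mul, e]
    ring

/-- Prices the points met while a shift of a component is only partly done: for `s` of order `1/A`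
the extra energy is of order `1/A²`. -/
theorem quadEnergy_add_ind_le (C : Network d) (T : Finset (Fin d)) (x : Fin d → ℝ) (s : ℝ) :
    quadEnergy C (x + s • ind T) ≤
      2 * quadEnergy C x + s ^ 2 * ∑ i, ∑ j, C.weight i j := by
  have h : ∀ i j, C.weight i j * ((x + s • ind T) i - (x + s • ind T) j) ^ 2 ≤
      2 * (C.weight i j * (x i - x j) ^ 2) + 2 * (s ^ 2 * C.weight i j) := fun i j => by
    have h1 : (ind T i - ind T j) ^ 2 ≤ 1 := by
      unfold ind; split_ifs <;> norm_num
    have h2 : ((x + s • ind T) i - (x + s • ind T) j) ^ 2 ≤ 2 * (x i - x j) ^ 2 + 2 * s ^ 2 := by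
      simp only [Pi.add_apply, Pi.smul_apply, smul_eq_mul]
      have := mul_le_mul_of_nonneg_left h1 (sq_nonneg s)
      nlinarith [sq_nonneg ((x i - x j) - s * (ind T i - ind T j))]
    have := mul_le_mul_of_nonneg_left h2 (C.nonneg i j)
    linarith
  have hs := Finset.sum_le_sum fun i (_ : i ∈ Finset.univ) =>
    Finset.sum_le_sum fun j (_ : j ∈ Finset.univ) => h i j
  simp only [Finset.sum_add_distrib, ← Finset.mul_sum] at hs
  unfold quadEnergy
  linarith

theorem ofReal_add_sq_le (a b : ℝ) :
    ENNReal.ofReal ((a + b) ^ 2) ≤ 2 * ENNReal.ofReal (a ^ 2) + 2 * ENNReal.ofReal (b ^ 2) := by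
  rw [← ENNReal.ofReal_ofNat 2, ← ENNReal.ofReal_mul zero_le_two, ← ENNReal.ofReal_mul zero_le_two,
    ← ENNReal.ofReal_add (by positivity) (by positivity)]
  exact ENNReal.ofReal_le_ofReal (by nlinarith [sq_nonneg (a - b)])

/-- The Dirichlet form, not normalized. -/
def dirichlet (C : Network d) (A : ℝ) (h : Cube d → ℝ) : ℝ≥0∞ :=
  partition C A * ∑ i, ∫⁻ p, ENNReal.ofReal ((h p - resample C A i h p) ^ 2) ∂stationary C A

/-- Moves the vertices of `T` one at a time. The two ends of a move differ only at `i`, where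
`resample C A i h` takes the same value, so the increment of `h` is that of `h - resample C A i h`;
each end is then controlled by the Dirichlet form. All subsets of `T` are needed in the hypothesis
because they are the intermediate stages. The constant comes from `2 * 10 ^ n + 8 ≤ 10 ^ (n + 1)`.
-/
theorem setLIntegral_shift_le (C : Network d) (A M s : ℝ) {h : Cube d → ℝ} (hh : BddMeas h)
    {G : Set (Fin d → ℝ)} (hG : MeasurableSet G) (v : Fin d → ℝ) (T : Finset (Fin d))
    (hT : ∀ x ∈ G, ∀ T' ⊆ T, x + v + s • ind T' ∈ Set.Icc (0 : Fin d → ℝ) 1 ∧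
      A ^ 2 * quadEnergy C (x + v + s • ind T') ≤ M) :
    ∫⁻ x in G, ENNReal.ofReal ((h (clamp (x + v + s • ind T)) - h (clamp (x + v))) ^ 2) ≤
      10 ^ T.card * (ENNReal.ofReal (Real.exp M) * dirichlet C A h) := by
  induction T using Finset.induction_on with
  | empty =>
    have : s • ind (∅ : Finset (Fin d)) = 0 := by ext; simp [ind]
    simp [this]
  | insert i T hi ih =>
    have ih' := ih fun x hx T' hT' => hT x hx T' (hT'.trans (Finset.subset_insert i T))
    set K := ENNReal.ofReal (Real.exp M) * dirichlet C A h
    set g : Cube d → ℝ := fun p => h p - resample C A i h p with hg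
    have hgm : Measurable g := hh.measurable.sub (hh.resample C A i).measurable
    set F : Cube d → ℝ≥0∞ := fun p => ENNReal.ofReal (g p ^ 2) with hFdef
    have hF : Measurable F := by fun_prop
    have hK : ENNReal.ofReal (Real.exp M) * (partition C A * ∫⁻ p, F p ∂stationary C A) ≤ K := by
      refine mul_le_mul_right (mul_le_mul_right ?_ _) _
      exact Finset.single_le_sum (f := fun i => ∫⁻ p, ENNReal.ofReal ((h p -
        resample C A i h p) ^ 2) ∂stationary C A) (fun _ _ => zero_le) (Finset.mem_univ i)
    have hb : ∀ T' ⊆ insert i T, ∫⁻ x in G, F (clamp (x + v + s • ind T')) ≤ K := fun T' hT' => by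
      refine le_trans ?_ hK
      simp only [add_assoc]
      refine setLIntegral_translate_le C A M hF hG _ fun x hx => ?_
      rw [← add_assoc]
      exact hT x hx T' hT'
    have hupd : ∀ x : Fin d → ℝ, x + s • ind (insert i T) =
        Function.update (x + s • ind T) i (x i + s) := fun x => by
      ext k
      by_cases hk : k = i
      · subst hk; simp [ind]
      · simp [ind, hk]
    have hpt : ∀ x : Fin d → ℝ,
        ENNReal.ofReal ((h (clamp (x + v + s • ind (insert i T))) - h (clamp (x + v))) ^ 2) ≤
        2 * ENNReal.ofReal ((h (clamp (x + v + s • ind T)) - h (clamp (x + v))) ^ 2) +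
        (4 * F (clamp (x + v + s • ind (insert i T))) + 4 * F (clamp (x + v + s • ind T))) := by
      intro x
      have hr : resample C A i h (clamp (x + v + s • ind (insert i T))) =
          resample C A i h (clamp (x + v + s • ind T)) := by
        rw [hupd, clamp_update, resample_update]
      have e : h (clamp (x + v + s • ind (insert i T))) - h (clamp (x + v)) =
          (h (clamp (x + v + s • ind T)) - h (clamp (x + v))) +
          (g (clamp (x + v + s • ind (insert i T))) + -g (clamp (x + v + s • ind T))) := by
        simp only [hg, hr]; ring
      rw [e]
      refine (ofReal_add_sq_le _ _).trans (add_le_add le_rfl ?_)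
      refine (mul_le_mul_right (ofReal_add_sq_le _ _) 2).trans (le_of_eq ?_)
      rw [neg_sq, mul_add, ← mul_assoc, ← mul_assoc]
      norm_num [hFdef]
    have hmt : ∀ w : Fin d → ℝ, Measurable fun x : Fin d → ℝ => clamp (x + w) := fun w =>
      measurable_clamp.comp (measurable_id.add_const w)
    have hhc : ∀ w : Fin d → ℝ, Measurable fun x : Fin d → ℝ => h (clamp (x + w)) := fun w =>
      hh.measurable.comp (hmt w)
    have m1 : Measurable fun x : Fin d → ℝ =>
        ENNReal.ofReal ((h (clamp (x + v + s • ind T)) - h (clamp (x + v))) ^ 2) := by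
      have h1 := hhc (v + s • ind T)
      simp only [← add_assoc] at h1
      exact ((h1.sub (hhc v)).pow_const 2).ennreal_ofReal
    have m2 : ∀ T', Measurable fun x : Fin d → ℝ => F (clamp (x + v + s • ind T')) := fun T' => by
      have h1 : Measurable fun x : Fin d → ℝ => F (clamp (x + (v + s • ind T'))) :=
        hF.comp (hmt _)
      simpa only [← add_assoc] using h1
    calc ∫⁻ x in G, ENNReal.ofReal ((h (clamp (x + v + s • ind (insert i T))) -
            h (clamp (x + v))) ^ 2)
        ≤ ∫⁻ x in G, (2 * ENNReal.ofReal ((h (clamp (x + v + s • ind T)) -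
            h (clamp (x + v))) ^ 2) + (4 * F (clamp (x + v + s • ind (insert i T))) +
            4 * F (clamp (x + v + s • ind T)))) := lintegral_mono hpt
      _ = 2 * (∫⁻ x in G, ENNReal.ofReal ((h (clamp (x + v + s • ind T)) -
            h (clamp (x + v))) ^ 2)) + (4 * (∫⁻ x in G, F (clamp (x + v + s • ind (insert i T)))) +
            4 * ∫⁻ x in G, F (clamp (x + v + s • ind T))) := by
          rw [lintegral_add_left (m1.const_mul 2), lintegral_add_left ((m2 _).const_mul 4),
            lintegral_const_mul _ m1, lintegral_const_mul _ (m2 _), lintegral_const_mul _ (m2 _)]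
      _ ≤ 2 * (10 ^ T.card * K) + (4 * K + 4 * K) := by
          gcongr
          · exact hb _ subset_rfl
          · exact hb _ (Finset.subset_insert i T)
      _ ≤ 10 ^ (insert i T).card * K := by
          rw [Finset.card_insert_of_notMem hi]
          have : (1 : ℝ≥0∞) ≤ 10 ^ T.card := one_le_pow₀ (by norm_num)
          calc 2 * (10 ^ T.card * K) + (4 * K + 4 * K)
              = (2 * 10 ^ T.card + 8 * 1) * K := by ring
            _ ≤ (2 * 10 ^ T.card + 8 * 10 ^ T.card) * K := by gcongr
            _ = 10 ^ (T.card + 1) * K := by ring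

/-- Cauchy-Schwarz over `N` successive shifts of all of `S`: one factor `N` from the inequality and
one from the number of terms. With `N` of order `A` this is the source of the time scale `A²`. -/
theorem setLIntegral_long_shift_le (C : Network d) (A M s : ℝ) {h : Cube d → ℝ} (hh : BddMeas h)
    {G : Set (Fin d → ℝ)} (hG : MeasurableSet G) (S : Finset (Fin d)) (N : ℕ)
    (hT : ∀ x ∈ G, ∀ l < N, ∀ T ⊆ S,
      x + ((l : ℝ) * s) • ind S + s • ind T ∈ Set.Icc (0 : Fin d → ℝ) 1 ∧
      A ^ 2 * quadEnergy C (x + ((l : ℝ) * s) • ind S + s • ind T) ≤ M) :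
    ∫⁻ x in G, ENNReal.ofReal ((h (clamp (x + ((N : ℝ) * s) • ind S)) - h (clamp x)) ^ 2) ≤
      N ^ 2 * (10 ^ d * (ENNReal.ofReal (Real.exp M) * dirichlet C A h)) := by
  set f : ℕ → (Fin d → ℝ) → ℝ := fun l x => h (clamp (x + ((l : ℝ) * s) • ind S)) with hf
  have hf0 : ∀ x, f 0 x = h (clamp x) := fun x => by simp [hf]
  have hfm : ∀ l, Measurable (f l) := fun l =>
    hh.measurable.comp (measurable_clamp.comp (measurable_id.add_const _))
  have hstep : ∀ l < N, ∫⁻ x in G, ENNReal.ofReal ((f (l + 1) x - f l x) ^ 2) ≤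
      10 ^ d * (ENNReal.ofReal (Real.exp M) * dirichlet C A h) := fun l hl => by
    have := setLIntegral_shift_le C A M s hh hG (((l : ℝ) * s) • ind S) S
      fun x hx T hTS => hT x hx l hl T hTS
    have e : ∀ x : Fin d → ℝ, x + ((l : ℝ) * s) • ind S + s • ind S =
        x + (((l + 1 : ℕ) : ℝ) * s) • ind S := fun x => by
      rw [add_assoc, ← add_smul]; push_cast; ring_nf
    simp only [e] at this
    refine this.trans ?_
    gcongr
    · norm_num
    · simpa using Finset.card_le_univ S
  have hpt : ∀ x, ENNReal.ofReal ((f N x - f 0 x) ^ 2) ≤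
      N * ∑ l ∈ Finset.range N, ENNReal.ofReal ((f (l + 1) x - f l x) ^ 2) := fun x => by
    rw [← ENNReal.ofReal_sum_of_nonneg fun _ _ => sq_nonneg _, ← ENNReal.ofReal_natCast,
      ← ENNReal.ofReal_mul (Nat.cast_nonneg N), ← Finset.sum_range_sub (fun l => f l x)]
    refine ENNReal.ofReal_le_ofReal ?_
    simpa using sq_sum_le_card_mul_sum_sq (s := Finset.range N)
      (f := fun l => f (l + 1) x - f l x)
  have hm : ∀ l, Measurable fun x => ENNReal.ofReal ((f (l + 1) x - f l x) ^ 2) := fun l => by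
    have h1 := hfm l
    have h2 := hfm (l + 1)
    fun_prop
  have e0 : ∀ x, h (clamp (x + ((N : ℝ) * s) • ind S)) - h (clamp x) = f N x - f 0 x :=
    fun x => by rw [hf0]
  simp only [e0]
  calc ∫⁻ x in G, ENNReal.ofReal ((f N x - f 0 x) ^ 2)
      ≤ ∫⁻ x in G, N * ∑ l ∈ Finset.range N, ENNReal.ofReal ((f (l + 1) x - f l x) ^ 2) :=
        lintegral_mono hpt
    _ = N * ∑ l ∈ Finset.range N, ∫⁻ x in G, ENNReal.ofReal ((f (l + 1) x - f l x) ^ 2) := by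
        rw [lintegral_const_mul _ (Finset.measurable_fun_sum _ fun l _ => hm l),
          lintegral_finsetSum _ fun l _ => hm l]
    _ ≤ N * ∑ l ∈ Finset.range N, 10 ^ d * (ENNReal.ofReal (Real.exp M) * dirichlet C A h) := by
        gcongr with l hl
        exact hstep l (Finset.mem_range.1 hl)
    _ = N ^ 2 * (10 ^ d * (ENNReal.ofReal (Real.exp M) * dirichlet C A h)) := by
        rw [Finset.sum_const, Finset.card_range, nsmul_eq_mul]; ring

/-! ### Concentration of the stationary measure near constant configurations -/

/-- Each of the `d` terms of the Green identity has, given the other coordinates, mean at most `1 /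
(2 A²)`, and resampling preserves stationary means. -/
theorem integral_energy_le (C : Network d) {A : ℝ} (hA : A ≠ 0) :
    ∫ p, energy C p ∂stationary C A ≤ d / (2 * A ^ 2) := by
  have hA2 : 0 < A ^ 2 := by positivity
  let f : Fin d → Cube d → ℝ := fun i p => toVec p i * (deg C i * toVec p i - field C i (toVec p))
  have hf : ∀ i, BddMeas (f i) := fun i => BddMeas.of_continuous (by
    have h1 := continuous_field C i
    have h2 := continuous_toVec (d := d)
    fun_prop)
  have hi : ∀ i, ∫ p, f i p ∂stationary C A ≤ 1 / (2 * A ^ 2) := fun i => by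
    rw [← integral_resample (hf i) C A i]
    have hr : ∀ p, resample C A i (f i) p ≤ 1 / (2 * A ^ 2) := fun p => by
      rw [resample_eq_integral_truncGauss (hf i)]
      have h := gauss_second_moment_le (A ^ 2 * deg C i) (A ^ 2 * field C i (toVec p))
      have e : ∀ x : unitInterval, f i (Function.update p i x) =
          (A ^ 2)⁻¹ * ((x : ℝ) * (A ^ 2 * deg C i * x - A ^ 2 * field C i (toVec p))) := fun x => by
        simp only [f, toVec_update, field_update, Function.update_self]
        field_simp
      simp only [e]
      rw [integral_const_mul]
      calc (A ^ 2)⁻¹ * _ ≤ (A ^ 2)⁻¹ * (1 / 2) := mul_le_mul_of_nonneg_left h (by positivity)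
        _ = 1 / (2 * A ^ 2) := by field_simp
    have := integral_mono (((hf i).resample C A i).integrable (stationary C A))
      (integrable_const _) hr
    simpa using this
  have e : ∀ p : Cube d, energy C p = ∑ i, f i p := fun p => by
    rw [energy_eq_quadEnergy, ← sum_deg_mul_sub_field]
  simp only [e]
  rw [integral_finsetSum _ fun i _ => (hf i).integrable _]
  calc ∑ i, ∫ p, f i p ∂stationary C A ≤ ∑ _i : Fin d, 1 / (2 * A ^ 2) :=
        Finset.sum_le_sum fun i _ => hi i
    _ = d / (2 * A ^ 2) := by simp [div_eq_mul_inv]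

/-- The points of the cube of low energy. -/
def lowEnergy (C : Network d) (A : ℝ) : Set (Fin d → ℝ) :=
  {x | x ∈ Set.Icc (0 : Fin d → ℝ) 1 ∧ A ^ 2 * quadEnergy C x ≤ d}

theorem measurableSet_lowEnergy (C : Network d) (A : ℝ) : MeasurableSet (lowEnergy C A) :=
  measurableSet_Icc.inter
    (measurableSet_le ((continuous_quadEnergy C).measurable.const_mul _) measurable_const)

/-- Markov's inequality at twice the bound on the mean energy leaves at least half of the mass. -/
theorem partition_le_lowEnergy [NeZero d] (C : Network d) {A : ℝ} (hA : A ≠ 0) :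
    partition C A ≤ 2 * ∫⁻ x in lowEnergy C A, density C A x := by
  have hA2 : 0 < A ^ 2 := by positivity
  have hd : (0 : ℝ) < d := by exact_mod_cast Nat.pos_of_ne_zero (NeZero.ne d)
  have hm : Measurable fun p : Cube d => A ^ 2 * energy C p := (measurable_energy C).const_mul _
  set L : Set (Cube d) := {p | A ^ 2 * energy C p ≤ d} with hLdef
  have hL : MeasurableSet L := measurableSet_le hm measurable_const
  have hmk : (stationary C A).real Lᶜ ≤ 1 / 2 := by
    have hint : Integrable (energy C) (stationary C A) :=
      integrable_of_continuous (continuous_energy C)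
    have h1 := mul_meas_ge_le_integral_of_nonneg
      (Filter.Eventually.of_forall fun p => energy_nonneg C p) hint (d / A ^ 2)
    have h2 : (stationary C A).real Lᶜ ≤ (stationary C A).real {p | d / A ^ 2 ≤ energy C p} := by
      refine measureReal_mono fun p hp => ?_
      simp only [hLdef, Set.mem_compl_iff, Set.mem_ofPred_eq, not_le] at hp ⊢
      rw [div_le_iff₀ hA2]; linarith
    have h3 := h1.trans (integral_energy_le C hA)
    have h4 : (d : ℝ) / (2 * A ^ 2) = d / A ^ 2 * (1 / 2) := by field_simp
    rw [h4] at h3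
    exact h2.trans (le_of_mul_le_mul_left h3 (by positivity))
  have hhalf : 1 ≤ 2 * stationary C A L := by
    rw [measureReal_compl hL, probReal_univ] at hmk
    have h5 : (1 / 2 : ℝ) ≤ (stationary C A).real L := by linarith
    rw [← ofReal_measureReal (μ := stationary C A) (s := L), ← ENNReal.ofReal_ofNat 2,
      ← ENNReal.ofReal_mul zero_le_two, ENNReal.one_le_ofReal]
    linarith
  have hpart := partition_mul_lintegral C A (F := L.indicator fun _ => 1)
    (measurable_const.indicator hL)
  rw [lintegral_indicator_const hL, one_mul] at hpart
  have hset : ∫⁻ x in Set.Icc (0 : Fin d → ℝ) 1, density C A x * L.indicator (fun _ => 1) (clamp x)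
      = ∫⁻ x in lowEnergy C A, density C A x := by
    rw [← lintegral_indicator measurableSet_Icc, ← lintegral_indicator (measurableSet_lowEnergy C A)]
    refine lintegral_congr fun x => ?_
    by_cases hx : x ∈ Set.Icc (0 : Fin d → ℝ) 1
    · have hq : energy C (clamp x) = quadEnergy C x := by
        rw [energy_eq_quadEnergy]
        congr 1
        ext i; exact coe_clamp hx i
      rw [Set.indicator_of_mem hx]
      by_cases hl : A ^ 2 * quadEnergy C x ≤ d
      · rw [Set.indicator_of_mem (show clamp x ∈ L by simpa [hLdef, hq] using hl),
          Set.indicator_of_mem (show x ∈ lowEnergy C A from ⟨hx, hl⟩), mul_one]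
      · rw [Set.indicator_of_notMem (show clamp x ∉ L by simpa [hLdef, hq] using hl),
          Set.indicator_of_notMem (show x ∉ lowEnergy C A from fun h => hl h.2), mul_zero]
    · rw [Set.indicator_of_notMem hx,
        Set.indicator_of_notMem (show x ∉ lowEnergy C A from fun h => hx h.1)]
  rw [← hset, ← hpart]
  calc partition C A = partition C A * 1 := (mul_one _).symm
    _ ≤ partition C A * (2 * stationary C A L) := by gcongr
    _ = 2 * (partition C A * stationary C A L) := by ring

/-- The points of low energy that are close to the corner `0` at the vertex `i`. -/
def cornerSet (C : Network d) (A : ℝ) (i : Fin d) (ε : ℝ) : Set (Fin d → ℝ) :=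
  {x | x ∈ lowEnergy C A ∧ x i < ε}

theorem measurableSet_cornerSet (C : Network d) (A : ℝ) (i : Fin d) (ε : ℝ) :
    MeasurableSet (cornerSet C A i ε) :=
  (measurableSet_lowEnergy C A).inter (measurableSet_lt (measurable_pi_apply i) measurable_const)

/-- The shifts of `cornerSet` along `S` cover `lowEnergy`. -/
theorem lowEnergy_le_cornerSet (C : Network d) {A : ℝ} {S : Finset (Fin d)}
    (hS : IsClosedSet C S) {i : Fin d} (hi : i ∈ S) {r η : ℝ} (hη : 0 < η)
    (hdiam : ∀ x, A ^ 2 * quadEnergy C x ≤ d → ∀ j ∈ S, |x j - x i| ≤ r)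
    {J : ℕ} (hJ : 1 < J * η) :
    ∫⁻ x in lowEnergy C A, density C A x ≤
      J * ∫⁻ x in cornerSet C A i (r + η), density C A x := by
  have hG := measurableSet_cornerSet C A i (r + η)
  set G := cornerSet C A i (r + η) with hGdef
  let sh : ℕ → (Fin d → ℝ) → (Fin d → ℝ) := fun j x => x + (-(j * η)) • ind S
  have hshm : ∀ j, Measurable (sh j) := fun j => measurable_id.add_const _
  have hcover : lowEnergy C A ⊆ ⋃ j ∈ Finset.range J, sh j ⁻¹' G := by
    intro x hx
    obtain ⟨⟨hx0, hx1⟩, hxE⟩ := hx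
    -- On `S` every coordinate is at least `x i - r`, so `x` can be lowered by `j` shifts without
    -- leaving the cube, and it then lands in the corner set. If `x i < r` the floor is 0 and no
    -- shift is made.
    set j := ⌊(x i - r) / η⌋₊ with hj
    have hub : x i - r < (j + 1) * η := by
      have := Nat.lt_floor_add_one ((x i - r) / η)
      rwa [div_lt_iff₀ hη] at this
    have hlb : ∀ k ∈ S, (j : ℝ) * η ≤ x k := fun k hk => by
      rcases Nat.eq_zero_or_pos j with h0 | h0
      · rw [h0]; simpa using hx0 k
      · have h1 : (j : ℝ) ≤ (x i - r) / η := by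
          refine Nat.floor_le ?_
          by_contra hneg
          rw [hj, Nat.floor_of_nonpos (not_le.1 hneg).le] at h0
          exact lt_irrefl _ h0
        rw [le_div_iff₀ hη] at h1
        have := (abs_le.1 (hdiam x hxE k hk)).1
        linarith
    have hjJ : j < J := by
      have h1 := hlb i hi
      have h2 := hx1 i
      simp only [Pi.one_apply] at h2
      have h3 : (j : ℝ) * η < J * η := by linarith
      exact_mod_cast lt_of_mul_lt_mul_right h3 hη.le
    refine Set.mem_biUnion (Finset.mem_coe.2 (Finset.mem_range.2 hjJ)) ?_
    have hjη : 0 ≤ (j : ℝ) * η := by positivity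
    refine ⟨⟨⟨fun k => ?_, fun k => ?_⟩, ?_⟩, ?_⟩
    · have h0 := hx0 k
      simp only [Pi.zero_apply] at h0
      by_cases hk : k ∈ S
      · have := hlb k hk
        simp [sh, ind, hk, this]
      · simpa [sh, ind, hk] using h0
    · have h1 := hx1 k
      simp only [Pi.one_apply] at h1
      by_cases hk : k ∈ S
      · simp only [sh, ind, hk, Pi.add_apply, Pi.smul_apply, if_true, smul_eq_mul, Pi.one_apply]
        linarith
      · simpa [sh, ind, hk] using h1
    · simp only [sh]
      rwa [quadEnergy_add_ind C hS]
    · simp only [sh, ind, hi, Pi.add_apply, Pi.smul_apply, if_true, smul_eq_mul]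
      linarith
  -- Lebesgue measure is translation invariant, and so is the density along the closed set `S`.
  have hinv : ∀ j, ∫⁻ x in sh j ⁻¹' G, density C A x = ∫⁻ x in G, density C A x := fun j => by
    rw [← lintegral_indicator (hshm j hG), ← lintegral_indicator hG,
      ← lintegral_add_right_eq_self (fun x => G.indicator (fun x => density C A x) x)
        ((-((j : ℝ) * η)) • ind S)]
    refine lintegral_congr fun x => ?_
    have hden : density C A (x + (-((j : ℝ) * η)) • ind S) = density C A x := by
      rw [density, density, quadEnergy_add_ind C hS]
    by_cases hx : x + (-((j : ℝ) * η)) • ind S ∈ G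
    · rw [Set.indicator_of_mem hx, Set.indicator_of_mem (show x ∈ sh j ⁻¹' G from hx), hden]
    · rw [Set.indicator_of_notMem hx, Set.indicator_of_notMem (show x ∉ sh j ⁻¹' G from hx)]
  calc ∫⁻ x in lowEnergy C A, density C A x
      ≤ ∫⁻ x in ⋃ j ∈ Finset.range J, sh j ⁻¹' G, density C A x := lintegral_mono_set hcover
    _ ≤ ∑ j ∈ Finset.range J, ∫⁻ x in sh j ⁻¹' G, density C A x := by
        simp only [← withDensity_apply' (density C A)]
        exact measure_biUnion_finset_le _ _
    _ = J * ∫⁻ x in G, density C A x := by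
        simp only [hinv, Finset.sum_const, Finset.card_range, nsmul_eq_mul]

/-! ### Connected components -/

/-- The existence of a path of positive weights. -/
def Joined (C : Network d) : Fin d → Fin d → Prop :=
  Relation.ReflTransGen fun i j => 0 < C.weight i j

open Classical in
/-- The connected component of a vertex. -/
def component (C : Network d) (i : Fin d) : Finset (Fin d) := Finset.univ.filter (Joined C i)

theorem mem_component {C : Network d} {i j : Fin d} : j ∈ component C i ↔ Joined C i j := by
  simp [component]

theorem self_mem_component (C : Network d) (i : Fin d) : i ∈ component C i :=
  mem_component.2 Relation.ReflTransGen.refl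

theorem isClosedSet_component (C : Network d) (i : Fin d) : IsClosedSet C (component C i) :=
  fun j k hjk => by
    rw [mem_component, mem_component]
    exact ⟨fun h => h.tail hjk, fun h => h.tail (C.symm j k ▸ hjk)⟩

/-- Induction along a path: the energy controls the squared difference across each edge, and `(u +
v)² ≤ 2 u² + 2 v²` adds an edge. -/
theorem exists_sq_sub_le_of_joined (C : Network d) {i j : Fin d} (h : Joined C i j) :
    ∃ R, 0 ≤ R ∧ ∀ x, (x j - x i) ^ 2 ≤ R * quadEnergy C x := by
  induction h with
  | refl => exact ⟨0, le_rfl, fun x => by simp⟩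
  | @tail b c _ hbc ih =>
    obtain ⟨R, hR0, hR⟩ := ih
    refine ⟨4 / C.weight b c + 2 * R, by positivity, fun x => ?_⟩
    have h1 : C.weight b c * (x b - x c) ^ 2 ≤ 2 * quadEnergy C x := by
      rw [quadEnergy, mul_div_cancel₀ _ two_ne_zero]
      have hnn : ∀ i j, 0 ≤ C.weight i j * (x i - x j) ^ 2 := fun i j =>
        mul_nonneg (C.nonneg i j) (sq_nonneg _)
      exact (Finset.single_le_sum (f := fun j => C.weight b j * (x b - x j) ^ 2)
        (fun j _ => hnn b j) (Finset.mem_univ c)).trans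
        (Finset.single_le_sum (f := fun i => ∑ j, C.weight i j * (x i - x j) ^ 2)
          (fun i _ => Finset.sum_nonneg fun j _ => hnn i j) (Finset.mem_univ b))
    have h2 : (x b - x c) ^ 2 ≤ 2 / C.weight b c * quadEnergy C x := by
      rw [div_mul_eq_mul_div, le_div_iff₀ hbc]; linarith
    have h3 : 4 / C.weight b c = 2 * (2 / C.weight b c) := by ring
    have h4 := hR x
    rw [h3]
    nlinarith [sq_nonneg ((x c - x b) - (x b - x i))]

theorem exists_component_diam (C : Network d) (i : Fin d) :
    ∃ R, 0 ≤ R ∧ ∀ x, ∀ j ∈ component C i, (x j - x i) ^ 2 ≤ R * quadEnergy C x := by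
  have h : ∀ j, ∃ R, 0 ≤ R ∧ (j ∈ component C i → ∀ x, (x j - x i) ^ 2 ≤ R * quadEnergy C x) := by
    intro j
    by_cases hj : j ∈ component C i
    · obtain ⟨R, h0, hR⟩ := exists_sq_sub_le_of_joined C (mem_component.1 hj)
      exact ⟨R, h0, fun _ => hR⟩
    · exact ⟨0, le_rfl, fun h => absurd h hj⟩
  choose R hR0 hR using h
  refine ⟨∑ j, R j, Finset.sum_nonneg fun j _ => hR0 j, fun x j hj => (hR j hj x).trans ?_⟩
  exact mul_le_mul_of_nonneg_right
    (Finset.single_le_sum (fun j _ => hR0 j) (Finset.mem_univ j)) (quadEnergy_nonneg C x)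

/-! ### The oscillation is controlled by the Dirichlet form -/

theorem vertexWeight_of_notMem (C : Network d) {S : Finset (Fin d)} {i : Fin d} (hi : i ∉ S) :
    vertexWeight C S i = 0 := by
  rw [vertexWeight, if_neg hi]

/-- Lifts the corner set along `S` by `1 - ε`. The monotonicity of `c₀ * weightedSum - h` makes `h`
at both ends close to its extreme values, so `h` gains at least `c` at every point of the set; the
long-shift estimate bounds the mean square of this gain. Coordinates outside `S` never matter, as
their vertex weight is 0. -/
theorem sq_oscillation_le [NeZero d] (C : Network d) {A : ℝ} (hA : 1 ≤ A) {S : Finset (Fin d)}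
    (hS : IsClosedSet C S) {i : Fin d} (hi : i ∈ S) {ε : ℝ} (hε : 0 < ε) (hε1 : ε < 1)
    (hdiam : ∀ x, A ^ 2 * quadEnergy C x ≤ d → ∀ j ∈ S, |x j - x i| ≤ ε / 4)
    {J : ℕ} (hJ : 1 < J * (ε / 2)) {h : Cube d → ℝ} (hh : BddMeas h)
    {c₀ : ℝ} (hc₀ : 0 ≤ c₀) (hreg : Monotone fun p => c₀ * weightedSum C S p - h p)
    {c : ℝ} (hc : 0 ≤ c) (hosc : c + 2 * (c₀ * (ε * ∑ j, vertexWeight C S j)) ≤ h 1 - h 0) :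
    ENNReal.ofReal (c ^ 2) ≤ 2 * J * (⌈A⌉₊ ^ 2 * (10 ^ d *
      (ENNReal.ofReal (Real.exp (2 * d + ∑ i, ∑ j, C.weight i j)) *
        ∑ i, ∫⁻ p, ENNReal.ofReal ((h p - resample C A i h p) ^ 2) ∂stationary C A))) := by
  have hA0 : 0 < A := by linarith
  -- The bound of `quadEnergy_add_ind_le` for a starting energy of at most `d / A²`, using `A s ≤
  -- 1`.
  set M : ℝ := 2 * d + ∑ i, ∑ j, C.weight i j with hM
  set N : ℕ := ⌈A⌉₊ with hN
  have hAN : A ≤ N := Nat.le_ceil A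
  have hN0 : (0 : ℝ) < N := by linarith
  set σ : ℝ := 1 - ε with hσ
  set s : ℝ := σ / N with hs
  have hs0 : 0 ≤ s := div_nonneg (by linarith) hN0.le
  have hNs : (N : ℝ) * s = σ := by rw [hs]; field_simp
  have hAs : A ^ 2 * s ^ 2 ≤ 1 := by
    rw [← mul_pow]
    refine pow_le_one₀ (mul_nonneg hA0.le hs0) ?_
    calc A * s ≤ N * s := mul_le_mul_of_nonneg_right hAN hs0
      _ ≤ 1 := by rw [hNs]; linarith
  -- The threshold `3 ε / 4` plus the diameter bound `ε / 4` puts all coordinates in `S` below `ε`.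
  set G := cornerSet C A i (ε / 4 + ε / 2) with hG
  have hGm : MeasurableSet G := measurableSet_cornerSet C A i _
  have hGε : ∀ x ∈ G, ∀ j ∈ S, x j ≤ ε := fun x hx j hj => by
    have h1 := (abs_le.1 (hdiam x hx.1.2 j hj)).2
    have h2 : x i < ε / 4 + ε / 2 := hx.2
    linarith
  have hW : 0 ≤ ∑ i, ∑ j, C.weight i j :=
    Finset.sum_nonneg fun i _ => Finset.sum_nonneg fun j _ => C.nonneg i j
  have hpath : ∀ x ∈ G, ∀ l < N, ∀ T ⊆ S,
      x + ((l : ℝ) * s) • ind S + s • ind T ∈ Set.Icc (0 : Fin d → ℝ) 1 ∧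
      A ^ 2 * quadEnergy C (x + ((l : ℝ) * s) • ind S + s • ind T) ≤ M := by
    intro x hx l hl T hTS
    have hl' : (l : ℝ) + 1 ≤ N := by exact_mod_cast hl
    have hls : ((l : ℝ) + 1) * s ≤ σ := hNs ▸ mul_le_mul_of_nonneg_right hl' hs0
    have hls0 : 0 ≤ (l : ℝ) * s := by positivity
    refine ⟨⟨fun k => ?_, fun k => ?_⟩, ?_⟩
    · have h0 := hx.1.1.1 k
      simp only [Pi.zero_apply, Pi.add_apply, Pi.smul_apply, smul_eq_mul, ind] at h0 ⊢
      split_ifs <;> linarith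
    · have h1 := hx.1.1.2 k
      simp only [Pi.one_apply, Pi.add_apply, Pi.smul_apply, smul_eq_mul, ind] at h1 ⊢
      by_cases hk : k ∈ S
      · have := hGε x hx k hk
        split_ifs <;> linarith
      · have hkT : k ∉ T := fun h => hk (hTS h)
        simp only [hk, hkT, if_false]
        linarith
    · have h1 := quadEnergy_add_ind_le C T (x + ((l : ℝ) * s) • ind S) s
      rw [quadEnergy_add_ind C hS] at h1
      have h2 := mul_le_mul_of_nonneg_left h1 (sq_nonneg A)
      have h3 : A ^ 2 * quadEnergy C x ≤ d := hx.1.2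
      have h4 := mul_le_mul_of_nonneg_right hAs hW
      rw [hM]
      nlinarith
  have hlong := setLIntegral_long_shift_le C A M s hh hGm S N hpath
  rw [hNs] at hlong
  have hΔ : ∀ x ∈ G, c ≤ h (clamp (x + σ • ind S)) - h (clamp x) := by
    intro x hx
    have hx0 := hx.1.1
    have hbox : x + σ • ind S ∈ Set.Icc (0 : Fin d → ℝ) 1 := by
      refine ⟨fun k => ?_, fun k => ?_⟩
      · have h0 := hx0.1 k
        simp only [Pi.zero_apply, Pi.add_apply, Pi.smul_apply, smul_eq_mul, ind] at h0 ⊢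
        split_ifs <;> linarith
      · have h1 := hx0.2 k
        simp only [Pi.one_apply, Pi.add_apply, Pi.smul_apply, smul_eq_mul, ind] at h1 ⊢
        by_cases hk : k ∈ S
        · have := hGε x hx k hk
          simp only [hk, if_true]; linarith
        · simp only [hk, if_false]; linarith
    have htop := hreg (cube_le_one (clamp (x + σ • ind S)))
    have hbot := hreg (cube_zero_le (clamp x))
    simp only at htop hbot
    have w0 : weightedSum C S 0 = 0 := by simp [weightedSum]
    have w1 : weightedSum C S (clamp x) ≤ ε * ∑ j, vertexWeight C S j := by
      rw [weightedSum, Finset.mul_sum]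
      refine Finset.sum_le_sum fun j _ => ?_
      by_cases hj : j ∈ S
      · rw [coe_clamp hx0, mul_comm]
        exact mul_le_mul_of_nonneg_right (hGε x hx j hj) (vertexWeight_nonneg C S j)
      · simp [vertexWeight_of_notMem C hj]
    have w2 : weightedSum C S 1 - weightedSum C S (clamp (x + σ • ind S)) ≤
        ε * ∑ j, vertexWeight C S j := by
      rw [weightedSum, weightedSum, ← Finset.sum_sub_distrib, Finset.mul_sum]
      refine Finset.sum_le_sum fun j _ => ?_
      by_cases hj : j ∈ S
      · rw [coe_clamp hbox, ← mul_sub, mul_comm]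
        refine mul_le_mul_of_nonneg_right ?_ (vertexWeight_nonneg C S j)
        have h0 := hx0.1 j
        simp only [Pi.zero_apply] at h0
        simp only [Pi.one_apply, Set.Icc.coe_one, Pi.add_apply, Pi.smul_apply, smul_eq_mul, ind, hj,
          if_true]
        linarith
      · simp [vertexWeight_of_notMem C hj]
    have w1' := mul_le_mul_of_nonneg_left w1 hc₀
    have w2' := mul_le_mul_of_nonneg_left w2 hc₀
    rw [w0] at hbot
    linarith
  -- The density is at most 1, so the Lebesgue integral of the squared gain dominates its
  -- density-weighted one. The mass of `G` is then compared with the partition function, which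
  -- cancels against the one in `dirichlet`.
  have hlow : ENNReal.ofReal (c ^ 2) * ∫⁻ x in G, density C A x ≤
      N ^ 2 * (10 ^ d * (ENNReal.ofReal (Real.exp M) * dirichlet C A h)) := by
    refine le_trans ?_ hlong
    rw [← lintegral_const_mul _ (measurable_density C A)]
    refine setLIntegral_mono' hGm fun x hx => ?_
    calc ENNReal.ofReal (c ^ 2) * density C A x ≤ ENNReal.ofReal (c ^ 2) * 1 := by
          gcongr; exact density_le_one C A x
      _ ≤ _ := by
          rw [mul_one]
          exact ENNReal.ofReal_le_ofReal (pow_le_pow_left₀ hc (hΔ x hx) 2)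
  have hZ : partition C A ≤ 2 * (J * ∫⁻ x in G, density C A x) :=
    (partition_le_lowEnergy C hA0.ne').trans (mul_le_mul_right
      (lowEnergy_le_cornerSet C hS hi (by positivity) hdiam hJ) 2)
  refine (ENNReal.mul_le_mul_iff_right (partition_ne_zero C A) (partition_ne_top C A)).1 ?_
  calc partition C A * ENNReal.ofReal (c ^ 2)
      ≤ 2 * (J * ∫⁻ x in G, density C A x) * ENNReal.ofReal (c ^ 2) := by gcongr
    _ = 2 * J * (ENNReal.ofReal (c ^ 2) * ∫⁻ x in G, density C A x) := by ring
    _ ≤ 2 * J * (N ^ 2 * (10 ^ d * (ENNReal.ofReal (Real.exp M) * dirichlet C A h))) := by gcongr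
    _ = _ := by rw [dirichlet]; ring

/-- Monotonicity puts the extremes at the corners `1` and `0`, and averaging can only bring extremes
together. -/
theorem oscillation_antitone [NeZero d] (C : Network d) (A : ℝ) {h : Cube d → ℝ} (hh : BddMeas h)
    (hm : ∀ k, Monotone (gibbsMean C A k h)) :
    Antitone fun k => gibbsMean C A k h 1 - gibbsMean C A k h 0 := by
  have hconst : ∀ (c : ℝ) (p : Cube d), gibbsOp C A (fun _ => c) p = c := fun c p => by
    have hd : (d : ℝ) ≠ 0 := by simpa using NeZero.ne d
    simp [gibbsOp, resample, hd]
  refine antitone_nat_of_succ_le fun k => ?_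
  have hb := hh.gibbsMean C A k
  rw [gibbsMean_succ C A k hh]
  have h1 := gibbsOp_mono hb (BddMeas.const _) (fun p => hm k (cube_le_one p)) C A 1
  have h2 := gibbsOp_mono (BddMeas.const _) hb (fun p => hm k (cube_zero_le p)) C A 0
  rw [hconst] at h1 h2
  linarith

theorem exists_oscillation_le [NeZero d] (C : Network d) (i : Fin d) {δ : ℝ} (hδ : 0 < δ) :
    ∃ α Astar : ℝ, 0 < α ∧ 1 ≤ Astar ∧ ∀ A, Astar ≤ A → ∀ k : ℕ, α * A ^ 2 ≤ k →
      gibbsMean C A k (fun q => (q i : ℝ)) 1 - gibbsMean C A k (fun q => (q i : ℝ)) 0 ≤ δ := by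
  set S := component C i
  have hS : IsClosedSet C S := isClosedSet_component C i
  have hi : i ∈ S := self_mem_component C i
  have hd : (0 : ℝ) < d := by exact_mod_cast Nat.pos_of_ne_zero (NeZero.ne d)
  set c₀ : ℝ := (vertexWeight C S i)⁻¹
  have hc₀ : 0 ≤ c₀ := (inv_pos.2 (vertexWeight_pos C hi)).le
  set Λ : ℝ := c₀ * ∑ j, vertexWeight C S j with hΛ
  have hΛ0 : 0 ≤ Λ := mul_nonneg hc₀ (Finset.sum_nonneg fun j _ => vertexWeight_nonneg C S j)
  obtain ⟨R, hR0, hR⟩ := exists_component_diam C i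
  -- Keeps the loss `2 ε Λ` at the two corners below half of `δ`.
  set ε : ℝ := min (1 / 2) (δ / (4 * (Λ + 1))) with hε
  have hε0 : 0 < ε := lt_min (by norm_num) (by positivity)
  have hε1 : ε < 1 := (min_le_left _ _).trans_lt (by norm_num)
  have hεΛ : 2 * (ε * Λ) ≤ δ / 2 := by
    have h1 : ε * (4 * (Λ + 1)) ≤ δ := (le_div_iff₀ (by positivity)).1 (min_le_right _ _)
    nlinarith
  obtain ⟨J, hJ⟩ := exists_nat_gt (1 / (ε / 2))
  have hJ' : 1 < J * (ε / 2) := (div_lt_iff₀ (by positivity)).1 hJ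
  set E : ℝ := Real.exp (2 * d + ∑ i, ∑ j, C.weight i j) with hE
  have hE0 : 0 < E := Real.exp_pos _
  -- The factor 8 is the 2 of `sq_oscillation_le` times the 4 of `⌈A⌉₊² ≤ 4 A²`.
  set B : ℝ := 8 * J * 10 ^ d * E * d with hB
  have hB0 : 0 ≤ B := by positivity
  -- The summand 1 makes `α (δ / 2)²` exceed `B`, which gives the contradiction. The second entry
  -- makes low-energy points vary by at most `ε / 4` on the component, since `A ≤ A²`.
  refine ⟨B / (δ / 2) ^ 2 + 1, max 1 (16 * R * d / ε ^ 2), by positivity, le_max_left _ _,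
    fun A hA k hk => ?_⟩
  have hA1 : 1 ≤ A := (le_max_left _ _).trans hA
  have hA2 : 16 * R * d / ε ^ 2 ≤ A ^ 2 :=
    ((le_max_right _ _).trans hA).trans (by nlinarith)
  have hA0 : A ≠ 0 := by linarith
  have hA2pos : 0 < A ^ 2 := by positivity
  set α : ℝ := B / (δ / 2) ^ 2 + 1 with hα
  have hα0 : 0 < α := by positivity
  have hk0 : (0 : ℝ) < k := lt_of_lt_of_le (by positivity) hk
  have hkpos : 0 < k := by exact_mod_cast hk0
  have hreg := gibbsMean_coord_regular C hA0 hS hi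
  have hcb := bddMeas_coord (d := d) i
  -- A good time `n` before `k` suffices, because the oscillation does not increase afterwards.
  obtain ⟨n, hn, hdir⟩ := exists_dirichlet_le hcb (fun p => by
    rw [abs_of_nonneg (p i).2.1]; exact (p i).2.2) C A hkpos
  refine (oscillation_antitone C A hcb (fun k => (hreg k).1) hn.le).trans ?_
  set h := gibbsMean C A n fun q => (q i : ℝ)
  have hh : BddMeas h := hcb.gibbsMean C A n
  by_contra hcon
  simp only [not_le] at hcon
  have hdiam : ∀ x, A ^ 2 * quadEnergy C x ≤ d → ∀ j ∈ S, |x j - x i| ≤ ε / 4 := by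
    intro x hx j hj
    refine abs_le_of_sq_le_sq ?_ (by positivity)
    refine (hR x j hj).trans ?_
    have h1 : R * d ≤ (ε / 4) ^ 2 * A ^ 2 := by
      rw [div_le_iff₀ (by positivity)] at hA2
      nlinarith
    have h2 := mul_le_mul_of_nonneg_left hx hR0
    refine le_of_mul_le_mul_right ?_ hA2pos
    linarith
  have key := sq_oscillation_le C hA1 hS hi hε0 hε1 hdiam hJ' hh hc₀ (hreg n).2
    (c := δ / 2) (by positivity) (by
      have : c₀ * (ε * ∑ j, vertexWeight C S j) = ε * Λ := by rw [hΛ]; ring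
      rw [this]; linarith)
  have hsum : ∑ i, ∫⁻ p, ENNReal.ofReal ((h p - resample C A i h p) ^ 2) ∂stationary C A ≤
      ENNReal.ofReal (d / k) := by
    have e : ∀ i, ∫⁻ p, ENNReal.ofReal ((h p - resample C A i h p) ^ 2) ∂stationary C A =
        ENNReal.ofReal (∫ p, (h p - resample C A i h p) ^ 2 ∂stationary C A) := fun i => by
      have hb := hh.sub (hh.resample C A i)
      have hb2 : Integrable (fun p => (h p - resample C A i h p) ^ 2) (stationary C A) := by
        simpa only [sq] using (hb.mul hb).integrable (stationary C A)
      exact (ofReal_integral_eq_lintegral_ofReal hb2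
        (Filter.Eventually.of_forall fun p => sq_nonneg _)).symm
    simp only [e]
    rw [← ENNReal.ofReal_sum_of_nonneg fun i _ => integral_nonneg fun p => sq_nonneg _]
    exact ENNReal.ofReal_le_ofReal hdir
  have key2 : ENNReal.ofReal ((δ / 2) ^ 2) ≤
      ENNReal.ofReal (2 * J * (⌈A⌉₊ ^ 2 * (10 ^ d * (E * (d / k))))) := by
    refine key.trans ?_
    rw [ENNReal.ofReal_mul (by positivity), ENNReal.ofReal_mul (by positivity),
      ENNReal.ofReal_mul (by positivity), ENNReal.ofReal_mul (by positivity),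
      ENNReal.ofReal_mul (by positivity), ENNReal.ofReal_pow (by positivity),
      ENNReal.ofReal_pow (by positivity), ENNReal.ofReal_natCast, ENNReal.ofReal_natCast,
      ENNReal.ofReal_ofNat, ENNReal.ofReal_ofNat]
    gcongr
  rw [ENNReal.ofReal_le_ofReal_iff (by positivity)] at key2
  have hN : (⌈A⌉₊ : ℝ) ≤ 2 * A := by
    have := (Nat.ceil_lt_add_one (by linarith : (0 : ℝ) ≤ A)).le
    linarith
  have hN2 : (⌈A⌉₊ : ℝ) ^ 2 ≤ 4 * A ^ 2 := by
    have := pow_le_pow_left₀ (Nat.cast_nonneg _) hN 2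
    linarith [this, (by ring : (2 * A) ^ 2 = 4 * A ^ 2)]
  have key3 : (δ / 2) ^ 2 ≤ B / α := by
    refine key2.trans ?_
    calc 2 * (J : ℝ) * ((⌈A⌉₊ : ℝ) ^ 2 * (10 ^ d * (E * (d / k))))
        ≤ 2 * J * (4 * A ^ 2 * (10 ^ d * (E * (d / (α * A ^ 2))))) := by gcongr
      _ = B / α := by rw [hB]; field_simp; ring
  rw [le_div_iff₀ hα0, hα, mul_add, mul_div_cancel₀ _ (by positivity)] at key3
  have : 0 < (δ / 2) ^ 2 := by positivity
  linarith

end GibbsSampler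

end

/-! ### Assembly of the two time regimes -/

theorem theorem2p2 {d : ℕ} (C : Network d) (hC : ∃ i j, 0 < C.weight i j)
    (δ : ℝ) (hδ : 0 < δ) :
    ∃ α α' Astar : ℝ, 0 < α ∧ 0 < α' ∧ ∀ A : ℝ, Astar ≤ A → ∀ k : ℕ,
      ((k : ℝ) ≤ α * A ^ 2 →
        ENNReal.ofReal (1 / 4 - δ) ≤
          (⨆ p : Cube d, dInfty ((gibbsKernel C A ^ k) p) (stationary C A))) ∧
      (α' * A ^ 2 ≤ (k : ℝ) →
        (⨆ p : Cube d, dInfty ((gibbsKernel C A ^ k) p) (stationary C A)) ≤ ENNReal.ofReal δ) := by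
  obtain ⟨i₀, j₀, hij⟩ := hC
  have hd0 : d ≠ 0 := fun h => by subst h; exact i₀.elim0
  have : NeZero d := ⟨hd0⟩
  have hd : (0 : ℝ) < d := by exact_mod_cast Nat.pos_of_ne_zero hd0
  have hdeg : 0 < deg C i₀ := hij.trans_le
    (Finset.single_le_sum (fun j _ => C.nonneg i₀ j) (Finset.mem_univ j₀))
  -- Tolerance `δ / d` for each coordinate, as the distance is bounded by a sum over the
  -- coordinates.
  choose α Astar hα hAstar hosc using fun i : Fin d =>
    exists_oscillation_le C i (δ := δ / d) (by positivity)
  -- Sums of positive constants stand in for maxima over the coordinates. The lower-bound constant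
  -- does not depend on `δ`, since 1/4 itself is reached there.
  refine ⟨deg C i₀ / 16, ∑ i, α i, ∑ i, Astar i, by positivity,
    Finset.sum_pos (fun i _ => hα i) ⟨i₀, Finset.mem_univ i₀⟩, fun A hA k => ⟨fun hk => ?_,
    fun hk => ?_⟩⟩
  · have hA1 : 1 ≤ A := (hAstar i₀).trans ((Finset.single_le_sum
      (fun i _ => zero_le_one.trans (hAstar i)) (Finset.mem_univ i₀)).trans hA)
    refine (ENNReal.ofReal_le_ofReal (by linarith)).trans
      ((dInfty_zero_ge C (by linarith) hdeg hk).trans ?_)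
    exact le_iSup (fun p => dInfty ((gibbsKernel C A ^ k) p) (stationary C A)) 0
  · refine iSup_le fun p => (dInfty_le_sum C A k p).trans ?_
    calc ∑ i, ENNReal.ofReal (gibbsMean C A k (fun q => (q i : ℝ)) 1 -
          gibbsMean C A k (fun q => (q i : ℝ)) 0)
        ≤ ∑ _i : Fin d, ENNReal.ofReal (δ / d) := by
          refine Finset.sum_le_sum fun i _ => ENNReal.ofReal_le_ofReal (hosc i A ?_ k ?_)
          · exact (Finset.single_le_sum (fun i _ => zero_le_one.trans (hAstar i))
              (Finset.mem_univ i)).trans hA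
          · exact (mul_le_mul_of_nonneg_right (Finset.single_le_sum (fun i _ => (hα i).le)
              (Finset.mem_univ i)) (sq_nonneg A)).trans hk
      _ = ENNReal.ofReal δ := by
          rw [Finset.sum_const, Finset.card_univ, Fintype.card_fin, nsmul_eq_mul,
            ← ENNReal.ofReal_natCast, ← ENNReal.ofReal_mul hd.le, mul_div_cancel₀ _ hd.ne']
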